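/- Let $W$ be a space-time white noise on a probability space $(\Omega,\mathcal F,\mathbb P)$, i.e. a centred Gaussian process $(W(t,A))$ indexed by $t\ge 0$ and bounded Borel sets $A\subset\mathbb R$, with $\mathbb E[W(t,A)W(t',A')]=(t\wedge t')\,\lambda(A\cap A')$, where $\lambda$ is Lebesgue measure. Let $$u(t,x)=\int_0^t\int_{\mathbb R}G(t-s,x-y)\,dW(s,y),\qquad t\ge 0,\ x\in\mathbb R,$$ (Wiener integral), with $G(t,x)=(2\pi t)^{-1/2}e^{-x^2/(2t)}$ for $t>0$ and $G(t,x)=0$ for $t\le 0$, be the mild solution of the stochastic heat equation $\partial_t u=\tfrac12\Delta u+\partial_t\partial_x W$ on $[0,\infty)\times\mathbb R$ with $u(0,\cdot)=0$; here $u$ is any version such that, for each fixed $x$, $(t,\omega)\mapsto u(t,x)(\omega)$ is measurable up to null sets (for instance, a version with almost surely continuous paths $t\mapsto u(t,x)$). For $I=[0,1]$, $1\le p<\infty$, $f\in L^p(I)$ and $t>0$ put $$\Delta_p(f)(t)=\sup_{|s|\le t}\Big(\int_{\{r\in I:\ r+s\in I\}}|f(r+s)-f(r)|^p\,dr\Big)^{1/p},$$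 and, for $0<\alpha<1$, $$\mathcal B^{\alpha}_p=\Big\{f\in L^p(I):\ \|f\|_{L^p(I)}+\sup_{0<t\le 1}\frac{\Delta_p(f)(t)}{t^{\alpha}}<\infty\Big\},\qquad \mathcal B^{\alpha,0}_p=\{f\in L^p(I):\ \Delta_p(f)(t)=o(t^\alpha)\text{ as }t\to0^+\}.$$ Then for all $x\in\mathbb R$ and $4<p<\infty$, $$\mathbb P\big(u(\cdot,x)\in\mathcal B^{1/4}_p\big)=1\qquad\text{and}\qquad \mathbb P\big(u(\cdot,x)\in\mathcal B^{1/4,0}_p\big)=0,$$ where $u(\cdot,x)$ is the sample path $t\in[0,1]\mapsto u(t,x)$. -/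

import Mathlib

open MeasureTheory ProbabilityTheory Set Filter Topology
open scoped NNReal ENNReal

namespace StochHeat

noncomputable section

/-! ### Space-time white noise -/

/-- The bounded Borel subsets of `ℝ`. -/
abbrev BddBorel : Type := {A : Set ℝ // MeasurableSet A ∧ Bornology.IsBounded A}

/-- `W` is a space-time white noise on `[0, ∞) × ℝ`: a centred Gaussian process
`W (t, A)`, indexed by `t ≥ 0` and bounded Borel sets `A`, with covariance
`E[W (t, A) W (t', A')] = min t t' * λ (A ∩ A')`. -/
structure IsWhiteNoise {Ω : Type*} [MeasurableSpace Ω] (P : Measure Ω)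
    (W : ℝ≥0 × BddBorel → Ω → ℝ) : Prop where
  gaussian : IsGaussianProcess W P
  centred : ∀ i, ∫ ω, W i ω ∂P = 0
  covariance : ∀ (t t' : ℝ≥0) (A A' : BddBorel),
    ∫ ω, W (t, A) ω * W (t', A') ω ∂P
      = ((min t t' : ℝ≥0) : ℝ) * volume.real (A.1 ∩ A'.1)

/-! ### The Wiener integral -/

/-- Lebesgue measure on `[0, ∞) × ℝ`, as a measure on `ℝ × ℝ`. -/
def spaceTime : Measure (ℝ × ℝ) := (volume.restrict (Ici (0 : ℝ))).prod volume

/-- The elementary function `∑ c_i 1_{[0, t_i] × A_i}` given by the finite family of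
coefficients `φ`. -/
def elemFun (φ : ℝ≥0 × BddBorel →₀ ℝ) (z : ℝ × ℝ) : ℝ :=
  φ.sum fun i c => c * (Icc (0 : ℝ) (i.1 : ℝ) ×ˢ i.2.1).indicator (fun _ => (1 : ℝ)) z

/-- The integral `∑ c_i W (t_i, A_i)` of that elementary function against `W`. -/
def elemIntegral {Ω : Type*} (W : ℝ≥0 × BddBorel → Ω → ℝ) (φ : ℝ≥0 × BddBorel →₀ ℝ)
    (ω : Ω) : ℝ :=
  φ.sum fun i c => c * W i ω

/-- `X` is (a version of) the Wiener integral `∫∫ f(s, y) dW(s, y)` of the square integrable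
deterministic function `f`: it is the limit in `L²(P)` of the integrals of elementary functions
that converge to `f` in `L²([0, ∞) × ℝ)`. -/
def IsWienerIntegral {Ω : Type*} [MeasurableSpace Ω] (P : Measure Ω)
    (W : ℝ≥0 × BddBorel → Ω → ℝ) (f : ℝ × ℝ → ℝ) (X : Ω → ℝ) : Prop :=
  MemLp f 2 spaceTime ∧ MemLp X 2 P ∧
    ∃ φ : ℕ → (ℝ≥0 × BddBorel →₀ ℝ),
      Tendsto (fun n => eLpNorm (fun z => elemFun (φ n) z - f z) 2 spaceTime) atTop (𝓝 0) ∧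
      Tendsto (fun n => eLpNorm (fun ω => elemIntegral W (φ n) ω - X ω) 2 P) atTop (𝓝 0)

/-! ### The mild solution of the stochastic heat equation -/

/-- The Green kernel of `∂_t - (1/2) Δ` on `ℝ`. -/
def greenKernel (t x : ℝ) : ℝ :=
  if 0 < t then (2 * Real.pi * t) ^ (-(1 / 2) : ℝ) * Real.exp (-(|x| ^ 2 / (2 * t))) else 0

/-- `u` is the mild solution of `∂_t u = (1/2) Δ u + Ẇ`, `u(0, ·) = 0`, that is
`u(t, x) = ∫_0^t ∫_ℝ G(t - s, x - y) dW(s, y)` almost surely, for all `t ≥ 0` and `x`.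
The kernel vanishes for `s ≥ t`, so that the integral is over all of `[0, ∞) × ℝ`.

Each Wiener integral is a random variable defined up to a null set, and sample paths make sense
only for a version that is measurable in `(t, ω)`; this is asked up to null sets, so that it holds
in particular for every version with almost surely continuous paths `t ↦ u(t, x)`. -/
structure IsMildSolution {Ω : Type*} [MeasurableSpace Ω] (P : Measure Ω)
    (W : ℝ≥0 × BddBorel → Ω → ℝ) (u : ℝ → ℝ → Ω → ℝ) : Prop where
  aestronglyMeasurable : ∀ x : ℝ,
    AEStronglyMeasurable (fun z : ℝ × Ω => u z.1 x z.2)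
      ((volume.restrict (Ici (0 : ℝ))).prod P)
  isWienerIntegral : ∀ t : ℝ, 0 ≤ t → ∀ x : ℝ,
    IsWienerIntegral P W (fun z => greenKernel (t - z.1) (x - z.2)) (u t x)

/-! ### Besov spaces on an interval -/

/-- The `L^p` modulus of continuity
`Δ_p(f, I)(t) = sup_{|s| ≤ t} ‖f(· + s) - f‖_{L^p(I_s)}`, `I_s = {x ∈ I | x + s ∈ I}`. -/
def lpModulus (p : ℝ≥0∞) (f : ℝ → ℝ) (I : Set ℝ) (t : ℝ) : ℝ≥0∞ :=
  ⨆ (s : ℝ) (_ : |s| ≤ t),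
    eLpNorm (fun x => f (x + s) - f x) p (volume.restrict {x | x ∈ I ∧ x + s ∈ I})

/-- The Besov norm `‖f‖_{L^p(I)} + sup_{0 < t ≤ 1} Δ_p(f, I)(t) / t^α`, with values in `[0, ∞]`. -/
def besovNorm (α : ℝ) (p : ℝ≥0∞) (I : Set ℝ) (f : ℝ → ℝ) : ℝ≥0∞ :=
  eLpNorm f p (volume.restrict I) +
    ⨆ (t : ℝ) (_ : 0 < t ∧ t ≤ 1), lpModulus p f I t / ENNReal.ofReal (t ^ α)

/-- `f` (restricted to `I`) belongs to the Besov space `B^α_p(I) = B^α_{p,∞}(I)`. -/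
def MemBesov (α : ℝ) (p : ℝ≥0∞) (I : Set ℝ) (f : ℝ → ℝ) : Prop :=
  MemLp f p (volume.restrict I) ∧ besovNorm α p I f < ∞

/-- `f` (restricted to `I`) belongs to the subspace `B^{α,0}_p(I)`:
`Δ_p(f, I)(t) = o(t^α)` as `t → 0+`. -/
def MemBesovZero (α : ℝ) (p : ℝ≥0∞) (I : Set ℝ) (f : ℝ → ℝ) : Prop :=
  MemLp f p (volume.restrict I) ∧
    Tendsto (fun t : ℝ => lpModulus p f I t / ENNReal.ofReal (t ^ α)) (𝓝[>] 0) (𝓝 0)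

end

end StochHeat

/-! Fix `x`. The Itô isometry gives the covariance of `t ↦ u t x` in closed form, κ(√(t + t') - √|t
- t'|) with κ = (2π)^{-1/2}. Hence the increment over [r, r + h] is centred Gaussian with variance
between κ√h and 3κ√h, uniformly in r ≥ 0 (`le_incrCov_diag`, `incrCov_diag_le`), so its typical size
is h^{1/4}. Both claims reduce to showing that the L^p norm in r of the increments normalised to
variance one stays bounded, and bounded away from 0, as h runs through the powers of 1/2.

This is a law of large numbers. Normalised increments at r and r' have correlation at most 4√h |r -
r'|^{-1/2}, and the covariance of their p-th absolute powers is at most a constant times that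
correlation (`exists_abs_integral_centred_abs_rpow_mul_le`). The singularity is integrable, so the
space average of the centred p-th powers has second moment O(√h). Along h = 2^{-n} this is summable,
and almost surely the L^p norms converge to the positive constant (E|N|^p)^{1/p}, N standard normal
(`ae_tendsto_eLpNorm_normIncr`).

So almost surely ‖u(· + 2^{-n}) - u‖_p is comparable to 2^{-n/4} for all large n. The lower bound
excludes the little-o space. The upper bound passes from dyadic shifts to all shifts because the L^p
norm of an increment is subadditive in the shift and tends to 0 with it
(`le_of_subadditive_of_dyadic`). Neither half needs path continuity. -/

namespace StochHeat

/-! ### Norms and inner products in L². -/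

section L2

variable {α : Type*} [MeasurableSpace α] {μ : Measure α}

lemma integral_sq_eq_toReal_eLpNorm_sq {X : α → ℝ} (hX : MemLp X 2 μ) :
    ∫ a, X a ^ 2 ∂μ = (eLpNorm X 2 μ).toReal ^ 2 := by
  have h0 : 0 ≤ ∫ a, X a ^ 2 ∂μ := integral_nonneg fun _ => sq_nonneg _
  rw [hX.eLpNorm_eq_integral_rpow_norm (by norm_num) (by norm_num)]
  have : ∀ a, ‖X a‖ ^ (2 : ℝ≥0∞).toReal = X a ^ 2 := fun a => by simp
  simp_rw [this]
  rw [ENNReal.toReal_ofReal (by positivity), ← Real.rpow_natCast, ← Real.rpow_mul h0]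
  simp

/-- Polarisation: an isometry stated for squares thereby yields one for products. -/
lemma four_mul_integral_mul {X Y : α → ℝ} (hX : MemLp X 2 μ) (hY : MemLp Y 2 μ) :
    4 * ∫ a, X a * Y a ∂μ = ∫ a, (X a + Y a) ^ 2 ∂μ - ∫ a, (X a - Y a) ^ 2 ∂μ := by
  have h1 : Integrable (fun a => (X a + Y a) ^ 2) μ := (hX.add hY).integrable_sq
  have h2 : Integrable (fun a => (X a - Y a) ^ 2) μ := (hX.sub hY).integrable_sq
  rw [← integral_sub h1 h2, ← integral_const_mul]
  exact integral_congr_ae (.of_forall fun z => by ring)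

lemma tendsto_eLpNorm_of_tendsto_eLpNorm_sub {p : ℝ≥0∞} (hp : 1 ≤ p) {f : ℕ → α → ℝ} {g : α → ℝ}
    (hf : ∀ n, AEStronglyMeasurable (f n) μ) (hg : MemLp g p μ)
    (h : Tendsto (fun n => eLpNorm (fun a => f n a - g a) p μ) atTop (𝓝 0)) :
    Tendsto (fun n => eLpNorm (f n) p μ) atTop (𝓝 (eLpNorm g p μ)) := by
  have hm : ∀ n, AEStronglyMeasurable (fun a => f n a - g a) μ :=
    fun n => (hf n).sub hg.aestronglyMeasurable
  have hup : Tendsto (fun n => eLpNorm (fun a => f n a - g a) p μ + eLpNorm g p μ) atTop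
      (𝓝 (eLpNorm g p μ)) := by
    simpa using h.add_const (eLpNorm g p μ)
  have hlo : Tendsto (fun n => eLpNorm g p μ - eLpNorm (fun a => f n a - g a) p μ) atTop
      (𝓝 (eLpNorm g p μ)) := by
    simpa using ENNReal.Tendsto.sub tendsto_const_nhds h (Or.inl hg.eLpNorm_ne_top)
  refine tendsto_of_tendsto_of_tendsto_of_le_of_le hlo hup (fun n => ?_) (fun n => ?_)
  · simp only [tsub_le_iff_right]
    calc eLpNorm g p μ = eLpNorm (f n - fun a => f n a - g a) p μ := by
          congr 1; ext a; simp
      _ ≤ _ := eLpNorm_sub_le (hf n) (hm n) hp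
  · calc eLpNorm (f n) p μ = eLpNorm ((fun a => f n a - g a) + g) p μ := by
          congr 1; ext a; simp
      _ ≤ _ := eLpNorm_add_le (hm n) hg.aestronglyMeasurable hp

end L2

/-! ### Gaussian laws under L² limits. -/

section GaussianLimit

variable {Ω : Type*} [MeasurableSpace Ω] {P : Measure Ω}

lemma map_eq_gaussianReal_of_centred {X : Ω → ℝ} (h : HasGaussianLaw X P)
    (h0 : ∫ ω, X ω ∂P = 0) : P.map X = gaussianReal 0 (∫ ω, X ω ^ 2 ∂P).toNNReal := by
  rw [h.map_eq_gaussianReal, h0, variance_of_integral_eq_zero h.aemeasurable h0]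

/-- An `L²` limit of centred Gaussian variables is centred Gaussian. -/
lemma map_eq_gaussianReal_of_tendsto_eLpNorm [IsProbabilityMeasure P] {X : ℕ → Ω → ℝ} {Y : Ω → ℝ}
    (hX : ∀ n, HasGaussianLaw (X n) P) (hX0 : ∀ n, ∫ ω, X n ω ∂P = 0) (hY : MemLp Y 2 P)
    (h : Tendsto (fun n => eLpNorm (fun ω => X n ω - Y ω) 2 P) atTop (𝓝 0)) :
    P.map Y = gaussianReal 0 (∫ ω, Y ω ^ 2 ∂P).toNNReal := by
  have hXm : ∀ n, AEStronglyMeasurable (X n) P := fun n => (hX n).aemeasurable.aestronglyMeasurable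
  have hY' : AEMeasurable Y P := hY.aestronglyMeasurable.aemeasurable
  have hvar : Tendsto (fun n => ∫ ω, X n ω ^ 2 ∂P) atTop (𝓝 (∫ ω, Y ω ^ 2 ∂P)) := by
    simp_rw [fun n => integral_sq_eq_toReal_eLpNorm_sq (hX n).memLp_two,
      integral_sq_eq_toReal_eLpNorm_sq hY]
    exact ((ENNReal.tendsto_toReal hY.eLpNorm_ne_top).comp
      (tendsto_eLpNorm_of_tendsto_eLpNorm_sub (by norm_num) hXm hY h)).pow 2
  have hdist := ((tendstoInMeasure_of_tendsto_eLpNorm (by norm_num) hXm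
    hY.aestronglyMeasurable h).tendstoInDistribution_of_aemeasurable
      (fun n => (hX n).aemeasurable) hY').tendsto
  have : IsProbabilityMeasure (P.map Y) := Measure.isProbabilityMeasure_map hY'
  -- Convergence in law gives pointwise convergence of characteristic functions; those of the
  -- Gaussians depend only on the variances, which converge by `hvar`.
  refine Measure.ext_of_charFun (funext fun t => ?_)
  have h1 := ProbabilityMeasure.tendsto_iff_tendsto_charFun.1 hdist t
  refine tendsto_nhds_unique h1 ?_
  simp only [ProbabilityMeasure.coe_mk, map_eq_gaussianReal_of_centred (hX _) (hX0 _),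
    charFun_gaussianReal]
  refine (Complex.continuous_exp.tendsto _).comp (Tendsto.sub ?_ ?_)
  · simp
  · refine (Tendsto.mul_const _ ?_).div_const _
    have hc : Continuous fun v : ℝ => ((v.toNNReal : ℝ) : ℂ) := by fun_prop
    exact (hc.tendsto _).comp hvar

end GaussianLimit

/-! ### The Wiener integral: linearity, isometry, joint Gaussian laws. -/

section Wiener

variable {Ω : Type*} [MeasurableSpace Ω] {P : Measure Ω} {W : ℝ≥0 × BddBorel → Ω → ℝ}

lemma elemFun_add (φ ψ : ℝ≥0 × BddBorel →₀ ℝ) (z : ℝ × ℝ) :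
    elemFun (φ + ψ) z = elemFun φ z + elemFun ψ z :=
  Finsupp.sum_add_index' (fun _ => zero_mul _) (fun _ _ _ => add_mul _ _ _)

lemma elemFun_smul (c : ℝ) (φ : ℝ≥0 × BddBorel →₀ ℝ) (z : ℝ × ℝ) :
    elemFun (c • φ) z = c * elemFun φ z := by
  rw [elemFun, Finsupp.sum_smul_index (fun _ => zero_mul _), elemFun, Finsupp.mul_sum]
  simp_rw [mul_assoc]

lemma elemIntegral_add {Ω : Type*} {W : ℝ≥0 × BddBorel → Ω → ℝ} (φ ψ : ℝ≥0 × BddBorel →₀ ℝ) (ω : Ω) :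
    elemIntegral W (φ + ψ) ω = elemIntegral W φ ω + elemIntegral W ψ ω :=
  Finsupp.sum_add_index' (fun _ => zero_mul _) (fun _ _ _ => add_mul _ _ _)

lemma elemIntegral_smul {Ω : Type*} {W : ℝ≥0 × BddBorel → Ω → ℝ} (c : ℝ)
    (φ : ℝ≥0 × BddBorel →₀ ℝ) (ω : Ω) :
    elemIntegral W (c • φ) ω = c * elemIntegral W φ ω := by
  rw [elemIntegral, Finsupp.sum_smul_index (fun _ => zero_mul _), elemIntegral, Finsupp.mul_sum]
  simp_rw [mul_assoc]

lemma measurable_elemFun (φ : ℝ≥0 × BddBorel →₀ ℝ) : Measurable (elemFun φ) := by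
  unfold elemFun Finsupp.sum
  refine Finset.measurable_sum _ fun i _ => Measurable.const_mul ?_ _
  exact measurable_const.indicator (measurableSet_Icc.prod i.2.2.1)

lemma IsWhiteNoise.hasGaussianLaw_elemIntegral (hW : IsWhiteNoise P W)
    (φ : ℝ≥0 × BddBorel →₀ ℝ) : HasGaussianLaw (elemIntegral W φ) P :=
  (hW.gaussian.smul fun i => φ i).hasGaussianLaw_fun_sum (I := φ.support)

lemma IsWhiteNoise.integral_elemIntegral (hW : IsWhiteNoise P W)
    (φ : ℝ≥0 × BddBorel →₀ ℝ) : ∫ ω, elemIntegral W φ ω ∂P = 0 := by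
  unfold elemIntegral Finsupp.sum
  rw [integral_finsetSum _ fun i _ =>
    (hW.gaussian.hasGaussianLaw_eval i).integrable.const_mul _]
  simp [integral_const_mul, hW.centred]

/-- This is the white noise covariance read as an L² inner product of indicators: the isometry on
generators. -/
lemma spaceTime_real_inter (i j : ℝ≥0 × BddBorel) :
    spaceTime.real ((Icc (0 : ℝ) i.1 ×ˢ i.2.1) ∩ (Icc (0 : ℝ) j.1 ×ˢ j.2.1))
      = ((min i.1 j.1 : ℝ≥0) : ℝ) * volume.real (i.2.1 ∩ j.2.1) := by
  rw [prod_inter_prod, Icc_inter_Icc, spaceTime, measureReal_prod_prod,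
    measureReal_restrict_apply measurableSet_Icc,
    inter_eq_left.2 (fun x hx => by simpa using hx.1)]
  simp

lemma spaceTime_lt_top (i : ℝ≥0 × BddBorel) :
    spaceTime (Icc (0 : ℝ) i.1 ×ˢ i.2.1) < ∞ := by
  rw [spaceTime, Measure.prod_prod]
  refine ENNReal.mul_lt_top ?_ i.2.2.2.measure_lt_top
  exact (Measure.restrict_apply_le _ _).trans_lt (by simp)

lemma memLp_elemFun (φ : ℝ≥0 × BddBorel →₀ ℝ) : MemLp (elemFun φ) 2 spaceTime := by
  unfold elemFun Finsupp.sum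
  refine memLp_finsetSum _ fun i _ => MemLp.const_mul ?_ _
  exact memLp_indicator_const _ (measurableSet_Icc.prod i.2.2.1) _ (Or.inr (spaceTime_lt_top i).ne)

/-- Used once for `W` and once for indicators, so that both sides of the isometry become the same
double sum. -/
lemma integral_sq_finsupp_sum {α ι : Type*} [MeasurableSpace α] {μ : Measure α} (φ : ι →₀ ℝ)
    {g : ι → α → ℝ} (hg : ∀ i, MemLp (g i) 2 μ) :
    ∫ a, (φ.sum fun i c => c * g i a) ^ 2 ∂μ
      = φ.sum fun i c => φ.sum fun j d => c * d * ∫ a, g i a * g j a ∂μ := by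
  have hint : ∀ i j, Integrable (fun a => g i a * g j a) μ := fun i j =>
    (hg i).integrable_mul (hg j)
  have : ∀ a, (φ.sum fun i c => c * g i a) ^ 2
      = ∑ i ∈ φ.support, ∑ j ∈ φ.support, φ i * φ j * (g i a * g j a) := fun a => by
    rw [Finsupp.sum, sq, Finset.sum_mul_sum]
    exact Finset.sum_congr rfl fun i _ => Finset.sum_congr rfl fun j _ => by ring
  simp_rw [this]
  rw [integral_finsetSum _ fun i _ => integrable_finsetSum _ fun j _ => (hint i j).const_mul _]
  refine Finset.sum_congr rfl fun i _ => ?_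
  rw [integral_finsetSum _ fun j _ => (hint i j).const_mul _]
  exact Finset.sum_congr rfl fun j _ => integral_const_mul _ _

lemma IsWhiteNoise.integral_sq_elemIntegral (hW : IsWhiteNoise P W) (φ : ℝ≥0 × BddBorel →₀ ℝ) :
    ∫ ω, elemIntegral W φ ω ^ 2 ∂P = ∫ z, elemFun φ z ^ 2 ∂spaceTime := by
  unfold elemIntegral elemFun
  rw [integral_sq_finsupp_sum φ (g := W) fun i => (hW.gaussian.hasGaussianLaw_eval i).memLp_two,
    integral_sq_finsupp_sum φ
      (g := fun i => (Icc (0 : ℝ) (i.1 : ℝ) ×ˢ i.2.1).indicator (fun _ => (1 : ℝ))) fun i =>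
      memLp_indicator_const _ (measurableSet_Icc.prod i.2.2.1) _ (Or.inr (spaceTime_lt_top i).ne)]
  refine Finsupp.sum_congr fun i _ => Finsupp.sum_congr fun j _ => ?_
  rw [hW.covariance, ← spaceTime_real_inter]
  simp_rw [← inter_indicator_mul, mul_one]
  rw [integral_indicator ((measurableSet_Icc.prod i.2.2.1).inter (measurableSet_Icc.prod j.2.2.1))]
  simp

lemma IsWhiteNoise.eLpNorm_elemIntegral (hW : IsWhiteNoise P W) (φ : ℝ≥0 × BddBorel →₀ ℝ) :
    eLpNorm (elemIntegral W φ) 2 P = eLpNorm (elemFun φ) 2 spaceTime := by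
  have h1 := (hW.hasGaussianLaw_elemIntegral φ).memLp_two
  have h2 := memLp_elemFun φ
  have h := hW.integral_sq_elemIntegral φ
  rw [integral_sq_eq_toReal_eLpNorm_sq h1, integral_sq_eq_toReal_eLpNorm_sq h2] at h
  exact (ENNReal.toReal_eq_toReal_iff' h1.eLpNorm_ne_top h2.eLpNorm_ne_top).1
    ((pow_left_inj₀ ENNReal.toReal_nonneg ENNReal.toReal_nonneg two_ne_zero).1 h)

namespace IsWienerIntegral

variable {f g : ℝ × ℝ → ℝ} {X Y : Ω → ℝ}

lemma add (hW : IsWhiteNoise P W) (hX : IsWienerIntegral P W f X)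
    (hY : IsWienerIntegral P W g Y) :
    IsWienerIntegral P W (fun z => f z + g z) (fun ω => X ω + Y ω) := by
  obtain ⟨hf, hX2, φ, hφ, hφX⟩ := hX
  obtain ⟨hg, hY2, ψ, hψ, hψY⟩ := hY
  refine ⟨hf.add hg, hX2.add hY2, fun n => φ n + ψ n, ?_, ?_⟩
  · refine tendsto_of_tendsto_of_tendsto_of_le_of_le tendsto_const_nhds
      (by simpa using hφ.add hψ) (fun _ => zero_le) fun n => ?_
    refine le_trans (le_of_eq ?_) (eLpNorm_add_le
      ((measurable_elemFun (φ n)).aestronglyMeasurable.sub hf.aestronglyMeasurable)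
      ((measurable_elemFun (ψ n)).aestronglyMeasurable.sub hg.aestronglyMeasurable) (by norm_num))
    congr 1
    ext z
    simp only [elemFun_add, Pi.add_apply]
    ring
  · refine tendsto_of_tendsto_of_tendsto_of_le_of_le tendsto_const_nhds
      (by simpa using hφX.add hψY) (fun _ => zero_le) fun n => ?_
    refine le_trans (le_of_eq ?_) (eLpNorm_add_le
      ((hW.hasGaussianLaw_elemIntegral (φ n)).aemeasurable.aestronglyMeasurable.sub
        hX2.aestronglyMeasurable)
      ((hW.hasGaussianLaw_elemIntegral (ψ n)).aemeasurable.aestronglyMeasurable.sub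
        hY2.aestronglyMeasurable) (by norm_num))
    congr 1
    ext ω
    simp only [elemIntegral_add, Pi.add_apply]
    ring

lemma const_mul (c : ℝ) (hX : IsWienerIntegral P W f X) :
    IsWienerIntegral P W (fun z => c * f z) (fun ω => c * X ω) := by
  obtain ⟨hf, hX2, φ, hφ, hφX⟩ := hX
  have key : ∀ {u : ℕ → ℝ≥0∞}, Tendsto u atTop (𝓝 0) →
      Tendsto (fun n => ‖c‖ₑ * u n) atTop (𝓝 0) := fun hu => by
    simpa using ENNReal.Tendsto.const_mul hu (Or.inr enorm_ne_top)
  refine ⟨hf.const_mul c, hX2.const_mul c, fun n => c • φ n, ?_, ?_⟩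
  · refine (key hφ).congr fun n => ?_
    rw [← eLpNorm_const_smul]
    congr 1
    ext z
    simp only [elemFun_smul, Pi.smul_apply, smul_eq_mul]
    ring
  · refine (key hφX).congr fun n => ?_
    rw [← eLpNorm_const_smul]
    congr 1
    ext ω
    simp only [elemIntegral_smul, Pi.smul_apply, smul_eq_mul]
    ring

lemma sub (hW : IsWhiteNoise P W) (hX : IsWienerIntegral P W f X)
    (hY : IsWienerIntegral P W g Y) :
    IsWienerIntegral P W (fun z => f z - g z) (fun ω => X ω - Y ω) := by
  simpa [sub_eq_add_neg] using hX.add hW (hY.const_mul (-1))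

lemma integral_sq (hW : IsWhiteNoise P W) (hX : IsWienerIntegral P W f X) :
    ∫ ω, X ω ^ 2 ∂P = ∫ z, f z ^ 2 ∂spaceTime := by
  obtain ⟨hf, hX2, φ, hφ, hφX⟩ := hX
  rw [integral_sq_eq_toReal_eLpNorm_sq hf, integral_sq_eq_toReal_eLpNorm_sq hX2]
  have h1 := tendsto_eLpNorm_of_tendsto_eLpNorm_sub (by norm_num)
    (fun n => (measurable_elemFun (φ n)).aestronglyMeasurable) hf hφ
  have h2 := tendsto_eLpNorm_of_tendsto_eLpNorm_sub (by norm_num)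
    (fun n => (hW.hasGaussianLaw_elemIntegral (φ n)).aemeasurable.aestronglyMeasurable) hX2 hφX
  have : (fun n => eLpNorm (fun ω => elemIntegral W (φ n) ω) 2 P)
      = fun n => eLpNorm (fun z => elemFun (φ n) z) 2 spaceTime :=
    funext fun n => hW.eLpNorm_elemIntegral (φ n)
  rw [tendsto_nhds_unique h2 (this ▸ h1)]

lemma integral_mul (hW : IsWhiteNoise P W) (hX : IsWienerIntegral P W f X)
    (hY : IsWienerIntegral P W g Y) :
    ∫ ω, X ω * Y ω ∂P = ∫ z, f z * g z ∂spaceTime := by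
  have h1 := (hX.add hW hY).integral_sq hW
  have h2 := (hX.sub hW hY).integral_sq hW
  have h3 := four_mul_integral_mul hX.2.1 hY.2.1
  have h4 := four_mul_integral_mul hX.1 hY.1
  rw [h1, h2] at h3
  linarith

lemma map_eq_gaussianReal [IsProbabilityMeasure P] (hW : IsWhiteNoise P W) (hX : IsWienerIntegral P W f X) :
    P.map X = gaussianReal 0 (∫ ω, X ω ^ 2 ∂P).toNNReal := by
  obtain ⟨-, hX2, φ, -, hφX⟩ := hX
  exact map_eq_gaussianReal_of_tendsto_eLpNorm (fun n => hW.hasGaussianLaw_elemIntegral (φ n))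
    (fun n => hW.integral_elemIntegral (φ n)) hX2 hφX

lemma aemeasurable (hX : IsWienerIntegral P W f X) : AEMeasurable X P :=
  hX.2.1.aestronglyMeasurable.aemeasurable

/-- Cramér–Wold: every linear functional of the pair is again a Wiener integral, by linearity, hence
Gaussian. -/
lemma hasGaussianLaw_prodMk [IsProbabilityMeasure P] (hW : IsWhiteNoise P W) (hX : IsWienerIntegral P W f X)
    (hY : IsWienerIntegral P W g Y) : HasGaussianLaw (fun ω => (X ω, Y ω)) P := by
  refine ⟨isGaussian_of_map_eq_gaussianReal fun L => ?_⟩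
  have hL : ∀ x y : ℝ, L (x, y) = L (1, 0) * x + L (0, 1) * y := fun x y => by
    have : ((x, y) : ℝ × ℝ) = x • (1, 0) + y • (0, 1) := by simp
    rw [this, map_add, map_smul, map_smul]
    simp [mul_comm]
  have h := ((hX.const_mul (L (1, 0))).add hW (hY.const_mul (L (0, 1)))).map_eq_gaussianReal hW
  refine ⟨0, _, Eq.trans ?_ h⟩
  rw [AEMeasurable.map_map_of_aemeasurable L.continuous.measurable.aemeasurable
    (hX.aemeasurable.prodMk hY.aemeasurable)]
  congr 1
  ext ω
  exact hL _ _

end IsWienerIntegral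

end Wiener

/-! ### The covariance function of the solution in time. -/

section Kernel

/-- Semigroup property: the heat kernel being even, the integral is the kernel at time a + b
evaluated at 0. -/
lemma integral_greenKernel_mul_greenKernel {a b : ℝ} (ha : 0 < a) (hb : 0 < b) (x : ℝ) :
    ∫ y, greenKernel a (x - y) * greenKernel b (x - y)
      = (2 * Real.pi) ^ (-(1 / 2) : ℝ) * (a + b) ^ (-(1 / 2) : ℝ) := by
  have hpi := Real.pi_pos
  rw [integral_sub_left_eq_self (fun y => greenKernel a y * greenKernel b y) volume x]
  have h1 : ∀ y : ℝ, greenKernel a y * greenKernel b y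
      = ((2 * Real.pi * a) ^ (-(1 / 2) : ℝ) * (2 * Real.pi * b) ^ (-(1 / 2) : ℝ))
        * Real.exp (-((a + b) / (2 * a * b)) * y ^ 2) := fun y => by
    rw [greenKernel, greenKernel, if_pos ha, if_pos hb, mul_mul_mul_comm, ← Real.exp_add, sq_abs]
    congr 2
    field_simp
    ring
  simp_rw [h1]
  rw [integral_const_mul, integral_gaussian, Real.sqrt_eq_rpow,
    ← Real.mul_rpow (by positivity) (by positivity), ← Real.mul_rpow (by positivity) (by positivity),
    Real.rpow_neg (by positivity), Real.rpow_neg (by positivity),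
    ← Real.inv_rpow (by positivity), ← Real.inv_rpow (by positivity),
    ← Real.mul_rpow (by positivity) (by positivity)]
  congr 1
  field_simp

/-- The exponent exceeds -1, so an endpoint singularity c = 2m is allowed; it occurs for equal
times. -/
lemma intervalIntegral_sub_two_mul_rpow {c m : ℝ} :
    ∫ s in (0 : ℝ)..m, (c - 2 * s) ^ (-(1 / 2) : ℝ) = √c - √(c - 2 * m) := by
  rw [intervalIntegral.integral_comp_sub_mul (fun v : ℝ => v ^ (-(1 / 2) : ℝ)) two_ne_zero,
    integral_rpow (Or.inl (by norm_num)), Real.sqrt_eq_rpow, Real.sqrt_eq_rpow]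
  norm_num
  ring

/-- The normalising constant `(2π)^{-1/2}`. -/
noncomputable def kappa : ℝ := (2 * Real.pi) ^ (-(1 / 2) : ℝ)

lemma kappa_pos : 0 < kappa := Real.rpow_pos_of_pos (by positivity) _

/-- The covariance function of `t ↦ u t x`. -/
noncomputable def timeCov (t t' : ℝ) : ℝ := kappa * (√(t + t') - √|t - t'|)

/-- Integrate in space first: the product lives on s < min t t', where it gives κ(t + t' -
2s)^{-1/2}. The time integral then stops at t + t' - 2 min t t' = |t - t'|. Fubini is justified by
the square integrability that is part of being a Wiener integral. -/
lemma integral_greenKernel_spaceTime {t t' x : ℝ} (ht : 0 ≤ t) (ht' : 0 ≤ t')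
    (h : MemLp (fun z : ℝ × ℝ => greenKernel (t - z.1) (x - z.2)) 2 spaceTime)
    (h' : MemLp (fun z : ℝ × ℝ => greenKernel (t' - z.1) (x - z.2)) 2 spaceTime) :
    ∫ z : ℝ × ℝ, greenKernel (t - z.1) (x - z.2) * greenKernel (t' - z.1) (x - z.2) ∂spaceTime
      = timeCov t t' := by
  have hint := h.integrable_mul h'
  rw [spaceTime] at hint ⊢
  have e := integral_prod _ hint
  simp only [Pi.mul_apply] at e
  rw [e]
  have hs : ∀ s : ℝ, ∫ y, greenKernel (t - s) (x - y) * greenKernel (t' - s) (x - y)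
      = (Iio (min t t')).indicator
        (fun s => kappa * (t + t' - 2 * s) ^ (-(1 / 2) : ℝ)) s := fun s => by
    by_cases hm : s < min t t'
    · rw [indicator_of_mem (mem_Iio.2 hm), integral_greenKernel_mul_greenKernel
        (sub_pos.2 (hm.trans_le (min_le_left _ _))) (sub_pos.2 (hm.trans_le (min_le_right _ _)))]
      rw [kappa]
      congr 2
      ring
    · rw [indicator_of_notMem (by simpa using hm)]
      have : ∀ y, greenKernel (t - s) (x - y) * greenKernel (t' - s) (x - y) = 0 := fun y => by
        rcases le_total t t' with hle | hle
        · rw [min_eq_left hle] at hm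
          rw [greenKernel, if_neg (by linarith), zero_mul]
        · rw [min_eq_right hle] at hm
          rw [mul_comm, greenKernel, if_neg (by linarith), zero_mul]
      simp [this]
  simp_rw [hs]
  rw [integral_indicator measurableSet_Iio, Measure.restrict_restrict measurableSet_Iio,
    inter_comm, Ici_inter_Iio, integral_Ico_eq_integral_Ioc,
    ← intervalIntegral.integral_of_le (le_min ht ht'), intervalIntegral.integral_const_mul,
    intervalIntegral_sub_two_mul_rpow, timeCov]
  congr 4
  rcases le_total t t' with hle | hle
  · rw [min_eq_left hle, abs_of_nonpos (by linarith)]; ring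
  · rw [min_eq_right hle, abs_of_nonneg (by linarith)]; ring

end Kernel

/-! ### Variance and covariance of increments. -/

section Increments

/-- The covariance of `u (r + h) x - u r x` and `u (r' + h) x - u r' x`. -/
noncomputable def incrCov (h r r' : ℝ) : ℝ :=
  timeCov (r + h) (r' + h) - timeCov (r + h) r' - timeCov r (r' + h) + timeCov r r'

lemma continuous_incrCov_diag (h : ℝ) : Continuous fun r => incrCov h r r := by
  unfold incrCov timeCov
  fun_prop

lemma abs_sqrt_sub_sqrt_le {a b d : ℝ} (ha : 0 ≤ a) (hb : 0 ≤ b) (hd : 0 < d) (hda : d ≤ a) :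
    |√a - √b| ≤ |a - b| / √d := by
  rw [le_div_iff₀ (Real.sqrt_pos.2 hd)]
  have h1 : |a - b| = |√a - √b| * (√a + √b) := by
    rw [← abs_of_nonneg (add_nonneg (Real.sqrt_nonneg a) (Real.sqrt_nonneg b)), ← abs_mul]
    congr 1
    rw [mul_comm, ← sq_sub_sq, Real.sq_sqrt ha, Real.sq_sqrt hb]
  rw [h1]
  exact mul_le_mul_of_nonneg_left
    ((Real.sqrt_le_sqrt hda).trans (le_add_of_nonneg_right (Real.sqrt_nonneg _))) (abs_nonneg _)

/-- The covariance is a combination of four differences of square roots with arguments at most h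
apart, one argument of each pair being at least |r - r'|. Each costs h / √|r - r'|, whence the 4. No
cancellation between them is used: the resulting singularity is already integrable. -/
lemma abs_incrCov_le {h r r' : ℝ} (hh : 0 ≤ h) (hr : 0 ≤ r) (hr' : 0 ≤ r') (hne : r ≠ r') :
    |incrCov h r r'| ≤ 4 * kappa * h / √|r - r'| := by
  set d := |r - r'| with hd
  have hdpos : 0 < d := abs_pos.2 (sub_ne_zero.2 hne)
  have hdle : d ≤ r + r' := abs_le.2 ⟨by linarith, by linarith⟩
  have h1 := abs_sqrt_sub_sqrt_le (a := r + r' + 2 * h) (b := r + r' + h) (by linarith)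
    (by linarith) hdpos (by linarith)
  have h2 := abs_sqrt_sub_sqrt_le (a := r + r') (b := r + r' + h) (by linarith)
    (by linarith) hdpos (by linarith)
  have h3 := abs_sqrt_sub_sqrt_le (a := d) (b := |r - r' + h|) hdpos.le (abs_nonneg _) hdpos le_rfl
  have h4 := abs_sqrt_sub_sqrt_le (a := d) (b := |r - r' - h|) hdpos.le (abs_nonneg _) hdpos le_rfl
  have e1 : |r + r' + 2 * h - (r + r' + h)| = h := by
    rw [show r + r' + 2 * h - (r + r' + h) = h by ring, abs_of_nonneg hh]
  have e2 : |r + r' - (r + r' + h)| = h := by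
    rw [show r + r' - (r + r' + h) = -h by ring, abs_neg, abs_of_nonneg hh]
  have e3 : |d - (|r - r' + h|)| ≤ h := by
    refine (abs_abs_sub_abs_le _ _).trans ?_
    rw [show r - r' - (r - r' + h) = -h by ring, abs_neg, abs_of_nonneg hh]
  have e4 : |d - (|r - r' - h|)| ≤ h := by
    refine (abs_abs_sub_abs_le _ _).trans ?_
    rw [show r - r' - (r - r' - h) = h by ring, abs_of_nonneg hh]
  rw [e1] at h1
  rw [e2] at h2
  have h3' := h3.trans (div_le_div_of_nonneg_right e3 (Real.sqrt_nonneg d))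
  have h4' := h4.trans (div_le_div_of_nonneg_right e4 (Real.sqrt_nonneg d))
  have key : incrCov h r r' = kappa * ((√(r + r' + 2 * h) - √(r + r' + h)) +
      (√(r + r') - √(r + r' + h)) - (√d - √|r - r' + h|) - (√d - √|r - r' - h|)) := by
    unfold incrCov timeCov
    rw [show r + h + (r' + h) = r + r' + 2 * h by ring, show r + h + r' = r + r' + h by ring,
      show r + (r' + h) = r + r' + h by ring, show r + h - (r' + h) = r - r' by ring,
      show r + h - r' = r - r' + h by ring, show r - (r' + h) = r - r' - h by ring, ← hd]
    ring
  rw [key, abs_mul, abs_of_pos kappa_pos, mul_comm 4 kappa, mul_assoc, mul_div_assoc]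
  refine mul_le_mul_of_nonneg_left ?_ kappa_pos.le
  rw [mul_div_assoc]
  rw [abs_le] at *
  constructor <;> linarith [h1.1, h1.2, h2.1, h2.2, h3'.1, h3'.2, h4'.1, h4'.2]

lemma incrCov_diag {h r : ℝ} (hh : 0 ≤ h) :
    incrCov h r r = kappa * (√(2 * r + 2 * h) + √(2 * r) - 2 * √(2 * r + h) + 2 * √h) := by
  unfold incrCov timeCov
  rw [show r + h + (r + h) = 2 * r + 2 * h by ring, show r + h + r = 2 * r + h by ring,
    show r + (r + h) = 2 * r + h by ring, show r + h - (r + h) = 0 by ring,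
    show r + h - r = h by ring, show r - (r + h) = -h by ring, abs_neg, abs_of_nonneg hh,
    sub_self, ← two_mul]
  simp
  ring

lemma sqrt_add_le_sqrt_add_sqrt {a b : ℝ} (ha : 0 ≤ a) (hb : 0 ≤ b) : √(a + b) ≤ √a + √b := by
  rw [Real.sqrt_le_left (by positivity), add_sq, Real.sq_sqrt ha, Real.sq_sqrt hb]
  have := mul_nonneg (Real.sqrt_nonneg a) (Real.sqrt_nonneg b)
  linarith

/-- Subadditivity and monotonicity of the root give 2√(2r + h) ≤ √(2r + 2h) + √(2r) + √h, which
consumes only one of the two √h. -/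
lemma le_incrCov_diag {h r : ℝ} (hh : 0 ≤ h) (hr : 0 ≤ r) : kappa * √h ≤ incrCov h r r := by
  rw [incrCov_diag hh]
  refine mul_le_mul_of_nonneg_left ?_ kappa_pos.le
  have h1 : √(2 * r + h) ≤ √(2 * r) + √h := sqrt_add_le_sqrt_add_sqrt (by linarith) hh
  have h2 : √(2 * r + h) ≤ √(2 * r + 2 * h) := Real.sqrt_le_sqrt (by linarith)
  linarith

/-- The terms containing r contribute at most one further √h to the 2√h. -/
lemma incrCov_diag_le {h r : ℝ} (hh : 0 ≤ h) (hr : 0 ≤ r) : incrCov h r r ≤ 3 * kappa * √h := by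
  rw [incrCov_diag hh, mul_comm 3 kappa, mul_assoc]
  refine mul_le_mul_of_nonneg_left ?_ kappa_pos.le
  have h1 : √(2 * r + h + h) ≤ √(2 * r + h) + √h := sqrt_add_le_sqrt_add_sqrt (by linarith) hh
  rw [show 2 * r + h + h = 2 * r + 2 * h by ring] at h1
  have h2 : √(2 * r) ≤ √(2 * r + h) := Real.sqrt_le_sqrt (by linarith)
  linarith

end Increments

/-! ### Covariances of the mild solution. -/

section MildSolution

variable {Ω : Type*} [MeasurableSpace Ω] {P : Measure Ω} {W : ℝ≥0 × BddBorel → Ω → ℝ}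
  {u : ℝ → ℝ → Ω → ℝ}

lemma IsMildSolution.isWienerIntegral_increment (hW : IsWhiteNoise P W)
    (hu : IsMildSolution P W u) {h r : ℝ} (hh : 0 ≤ h) (hr : 0 ≤ r) (x : ℝ) :
    IsWienerIntegral P W
      (fun z => greenKernel (r + h - z.1) (x - z.2) - greenKernel (r - z.1) (x - z.2))
      (fun ω => u (r + h) x ω - u r x ω) :=
  (hu.isWienerIntegral (r + h) (by positivity) x).sub hW (hu.isWienerIntegral r hr x)

lemma IsMildSolution.integral_mul (hW : IsWhiteNoise P W) (hu : IsMildSolution P W u)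
    {t t' : ℝ} (ht : 0 ≤ t) (ht' : 0 ≤ t') (x : ℝ) :
    ∫ ω, u t x ω * u t' x ω ∂P = timeCov t t' := by
  have h := hu.isWienerIntegral t ht x
  have h' := hu.isWienerIntegral t' ht' x
  rw [h.integral_mul hW h', integral_greenKernel_spaceTime ht ht' h.1 h'.1]

lemma IsMildSolution.integral_increment_mul (hW : IsWhiteNoise P W) (hu : IsMildSolution P W u)
    {h r r' : ℝ} (hh : 0 ≤ h) (hr : 0 ≤ r) (hr' : 0 ≤ r') (x : ℝ) :
    ∫ ω, (u (r + h) x ω - u r x ω) * (u (r' + h) x ω - u r' x ω) ∂P = incrCov h r r' := by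
  have hL : ∀ t, 0 ≤ t → MemLp (u t x) 2 P := fun t ht => (hu.isWienerIntegral t ht x).2.1
  have hi : ∀ t t', 0 ≤ t → 0 ≤ t' → Integrable (fun ω => u t x ω * u t' x ω) P :=
    fun t t' ht ht' => (hL t ht).integrable_mul (hL t' ht')
  have hrh : 0 ≤ r + h := by positivity
  have hrh' : 0 ≤ r' + h := by positivity
  have e : ∀ ω, (u (r + h) x ω - u r x ω) * (u (r' + h) x ω - u r' x ω)
      = u (r + h) x ω * u (r' + h) x ω - u (r + h) x ω * u r' x ω
        - u r x ω * u (r' + h) x ω + u r x ω * u r' x ω := fun ω => by ring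
  simp_rw [e]
  have i1 : Integrable (fun ω => u (r + h) x ω * u (r' + h) x ω - u (r + h) x ω * u r' x ω) P :=
    (hi _ _ hrh hrh').sub (hi _ _ hrh hr')
  have i2 : Integrable (fun ω => u (r + h) x ω * u (r' + h) x ω - u (r + h) x ω * u r' x ω
      - u r x ω * u (r' + h) x ω) P := i1.sub (hi _ _ hr hrh')
  rw [integral_add i2 (hi _ _ hr hr'), integral_sub i1 (hi _ _ hr hrh'),
    integral_sub (hi _ _ hrh hrh') (hi _ _ hrh hr'), hu.integral_mul hW hrh hrh',
    hu.integral_mul hW hrh hr', hu.integral_mul hW hr hrh', hu.integral_mul hW hr hr', incrCov]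

end MildSolution

/-! ### Absolute moments of Gaussian variables and their decorrelation. -/

section GaussianMoments

/-- The absolute moment of order `q` of the standard Gaussian law. -/
noncomputable def absMoment (q : ℝ) : ℝ := ∫ y, |y| ^ q ∂gaussianReal 0 1

lemma absMoment_nonneg (q : ℝ) : 0 ≤ absMoment q :=
  integral_nonneg fun _ => by positivity

lemma integrable_abs_rpow_gaussianReal {q : ℝ} (hq : 0 ≤ q) (v : ℝ≥0) :
    Integrable (fun y : ℝ => |y| ^ q) (gaussianReal 0 v) := by
  have := (memLp_id_gaussianReal (μ := 0) (v := v) q.toNNReal).integrable_norm_rpow'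
  simpa [hq] using this

lemma absMoment_pos {q : ℝ} (hq : 0 ≤ q) : 0 < absMoment q := by
  rw [absMoment, integral_pos_iff_support_of_nonneg (fun _ => by positivity)
    (integrable_abs_rpow_gaussianReal hq 1)]
  have h : ({0}ᶜ : Set ℝ) ⊆ Function.support fun y : ℝ => |y| ^ q := fun y hy => by
    have : 0 < |y| := abs_pos.2 hy
    exact (Real.rpow_pos_of_pos this q).ne'
  refine lt_of_lt_of_le ?_ (measure_mono h)
  have := nullSingletonClass_gaussianReal (μ := 0) one_ne_zero
  rw [prob_compl_eq_one_sub (measurableSet_singleton _), measure_singleton]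
  simp

variable {Ω : Type*} [MeasurableSpace Ω] {P : Measure Ω} {X Y : Ω → ℝ}

lemma integrable_abs_rpow_of_map {q : ℝ} (hq : 0 ≤ q) (hX : AEMeasurable X P) {v : ℝ≥0}
    (h : P.map X = gaussianReal 0 v) : Integrable (fun ω => |X ω| ^ q) P := by
  have := integrable_abs_rpow_gaussianReal hq v
  rw [← h] at this
  exact this.comp_aemeasurable hX

lemma integral_abs_rpow_of_map {q : ℝ} (hX : AEMeasurable X P) {v : ℝ≥0}
    (h : P.map X = gaussianReal 0 v) :
    ∫ ω, |X ω| ^ q ∂P = √(v : ℝ) ^ q * absMoment q := by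
  have hm : Measurable fun y : ℝ => |y| ^ q := by fun_prop
  have hv : gaussianReal 0 v = (gaussianReal 0 1).map (√(v : ℝ) * ·) := by
    rw [gaussianReal_map_const_mul]
    congr 1
    · simp
    · ext; simp
  calc ∫ ω, |X ω| ^ q ∂P = ∫ y, |y| ^ q ∂(P.map X) :=
        (integral_map hX hm.aestronglyMeasurable).symm
    _ = ∫ y, |√(v : ℝ) * y| ^ q ∂gaussianReal 0 1 := by
        rw [h, hv, integral_map (by fun_prop) hm.aestronglyMeasurable]
    _ = _ := by
        rw [absMoment, ← integral_const_mul]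
        refine integral_congr_ae (.of_forall fun y => ?_)
        simp only
        rw [abs_mul, abs_of_nonneg (Real.sqrt_nonneg _),
          Real.mul_rpow (Real.sqrt_nonneg _) (abs_nonneg _)]

lemma integral_abs_rpow_le_absMoment {q : ℝ} (hq : 0 ≤ q) (hX : AEMeasurable X P) {v : ℝ≥0}
    (hv : v ≤ 1) (h : P.map X = gaussianReal 0 v) : ∫ ω, |X ω| ^ q ∂P ≤ absMoment q := by
  rw [integral_abs_rpow_of_map hX h]
  refine mul_le_of_le_one_left (absMoment_nonneg q) (Real.rpow_le_one (Real.sqrt_nonneg _) ?_ hq)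
  simpa using hv

lemma rpow_sub_rpow_le {q a b : ℝ} (hq : 1 ≤ q) (hb : 0 ≤ b) (hba : b ≤ a) :
    a ^ q - b ^ q ≤ q * (a - b) * a ^ (q - 1) := by
  rcases (hb.trans hba).eq_or_lt with h0 | ha
  · have : b = 0 := le_antisymm (by linarith) hb
    rw [← h0, this]; simp
  -- Bernoulli's inequality for (b/a)^q, with b/a = 1 + (b - a)/a.
  · have h := one_add_mul_self_le_rpow_one_add (s := (b - a) / a) (p := q)
      (by rw [le_div_iff₀ ha]; linarith) hq
    have e : 1 + (b - a) / a = b / a := by field_simp; ring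
    rw [e, Real.div_rpow hb ha.le, le_div_iff₀ (Real.rpow_pos_of_pos ha q)] at h
    have e2 : a ^ q = a ^ (q - 1) * a := by
      rw [← Real.rpow_add_one ha.ne']; congr 1; ring
    have e3 : q * ((b - a) / a) * a ^ q = - (q * (a - b) * a ^ (q - 1)) := by
      rw [e2]; field_simp; ring
    nlinarith

lemma abs_rpow_sub_rpow_le {q a b M : ℝ} (hq : 1 ≤ q) (ha : 0 ≤ a) (hb : 0 ≤ b) (haM : a ≤ M)
    (hbM : b ≤ M) : |a ^ q - b ^ q| ≤ q * |a - b| * M ^ (q - 1) := by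
  have key : ∀ {a b : ℝ}, 0 ≤ b → b ≤ a → a ≤ M → |a ^ q - b ^ q| ≤ q * |a - b| * M ^ (q - 1) := by
    intro a b hb hba haM
    rw [abs_of_nonneg (sub_nonneg.2 (Real.rpow_le_rpow hb hba (by linarith))),
      abs_of_nonneg (sub_nonneg.2 hba)]
    refine (rpow_sub_rpow_le hq hb hba).trans (mul_le_mul_of_nonneg_left ?_ ?_)
    · exact Real.rpow_le_rpow (hb.trans hba) haM (by linarith)
    · exact mul_nonneg (by linarith) (sub_nonneg.2 hba)
  rcases le_total b a with h | h
  · exact key hb h haM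
  · rw [abs_sub_comm, abs_sub_comm a b]; exact key ha h hbM

lemma add_add_rpow_le {r a b c : ℝ} (hr : 0 ≤ r) (ha : 0 ≤ a) (hb : 0 ≤ b) (hc : 0 ≤ c) :
    (a + b + c) ^ r ≤ 3 ^ r * (a ^ r + b ^ r + c ^ r) := by
  have ha' := Real.rpow_nonneg ha r
  have hb' := Real.rpow_nonneg hb r
  have hc' := Real.rpow_nonneg hc r
  have key : ∀ m, 0 ≤ m → a ≤ m → b ≤ m → c ≤ m → m ^ r ≤ a ^ r + b ^ r + c ^ r →
      (a + b + c) ^ r ≤ 3 ^ r * (a ^ r + b ^ r + c ^ r) := fun m hm h1 h2 h3 h4 =>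
    (Real.rpow_le_rpow (by positivity) (by linarith : a + b + c ≤ 3 * m) hr).trans (by
      rw [Real.mul_rpow (by norm_num) hm]
      exact mul_le_mul_of_nonneg_left h4 (by positivity))
  rcases le_total a b with hab | hab
  · rcases le_total b c with hbc | hbc
    · exact key c hc (hab.trans hbc) hbc le_rfl (by linarith)
    · exact key b hb hab le_rfl hbc (by linarith)
  · rcases le_total a c with hac | hac
    · exact key c hc hac (hab.trans hac) le_rfl (by linarith)
    · exact key a ha le_rfl hab hac (by linarith)

/-- For jointly Gaussian standard variables, the covariance of the `q`-th powers of the absolute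
values is controlled by the correlation. -/
lemma exists_abs_integral_centred_abs_rpow_mul_le [IsProbabilityMeasure P] {q : ℝ} (hq : 1 ≤ q) :
    ∃ C : ℝ, 0 ≤ C ∧ ∀ X Y : Ω → ℝ, HasGaussianLaw (fun ω => (X ω, Y ω)) P →
      P.map X = gaussianReal 0 1 → P.map Y = gaussianReal 0 1 →
      |∫ ω, (|X ω| ^ q - absMoment q) * (|Y ω| ^ q - absMoment q) ∂P|
        ≤ C * |∫ ω, X ω * Y ω ∂P| := by
  set c := absMoment q with hc
  have hc0 : 0 ≤ c := absMoment_nonneg q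
  have hq0 : 0 ≤ q := by linarith
  -- The constant is the expectation bound for the dominating function in `hpt`, using E[M^r] ≤ 3^r
  -- · 3 · `absMoment r` at r = 2q and r = q.
  refine ⟨q * (3 ^ (q + q) * (3 * absMoment (q + q)) + c * (3 ^ q * (3 * c))), ?_,
    fun X Y hXY hX hY => ?_⟩
  · have := absMoment_nonneg (q + q)
    positivity
  have hXm := hXY.fst.aemeasurable
  have hYm := hXY.snd.aemeasurable
  have hmean : ∀ {V : Ω → ℝ}, HasGaussianLaw V P → P.map V = gaussianReal 0 1 →
      ∫ ω, V ω ∂P = 0 ∧ ∫ ω, V ω ^ 2 ∂P = 1 := fun {V} hV hVl => by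
    have h0 : ∫ ω, V ω ∂P = 0 := by
      rw [← integral_map (f := fun y => y) hV.aemeasurable (by fun_prop), hVl,
        integral_id_gaussianReal]
    refine ⟨h0, ?_⟩
    have h1 := variance_of_integral_eq_zero hV.aemeasurable h0
    rw [← h1, ← variance_id_map hV.aemeasurable, hVl, variance_id_gaussianReal]
    rfl
  obtain ⟨hX0, hX2⟩ := hmean hXY.fst hX
  obtain ⟨hY0, hY2⟩ := hmean hXY.snd hY
  have hXL := hXY.fst.memLp_two
  have hYL := hXY.snd.memLp_two
  have hXYi : Integrable (fun ω => X ω * Y ω) P := hXL.integrable_mul hYL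
  set ρ := ∫ ω, X ω * Y ω ∂P with hρ
  -- Regression: Y = ρX + Z with Z uncorrelated with X, hence independent of it by joint normality.
  -- Replacing |Y|^q by |Z|^q costs O(|ρ|), and afterwards independence makes the covariance vanish.
  set Z : Ω → ℝ := fun ω => Y ω - ρ * X ω with hZ
  have hXZ : HasGaussianLaw (fun ω => (X ω, Z ω)) P :=
    hXY.map_fun ((ContinuousLinearMap.fst ℝ ℝ ℝ).prod
      (ContinuousLinearMap.snd ℝ ℝ ℝ - ρ • ContinuousLinearMap.fst ℝ ℝ ℝ))
  have hZm := hXZ.snd.aemeasurable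
  have hZ0 : ∫ ω, Z ω ∂P = 0 := by
    rw [hZ, integral_sub hXY.snd.integrable (hXY.fst.integrable.const_mul ρ), integral_const_mul,
      hX0, hY0]
    simp
  have hZ2 : ∫ ω, Z ω ^ 2 ∂P = 1 - ρ ^ 2 := by
    have e : ∀ ω, Z ω ^ 2 = Y ω ^ 2 - 2 * ρ * (X ω * Y ω) + ρ ^ 2 * X ω ^ 2 := fun ω => by
      simp only [hZ]; ring
    simp_rw [e]
    have i1 : Integrable (fun ω => Y ω ^ 2 - 2 * ρ * (X ω * Y ω)) P :=
      hYL.integrable_sq.sub (hXYi.const_mul _)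
    rw [integral_add i1 (hXL.integrable_sq.const_mul _),
      integral_sub hYL.integrable_sq (hXYi.const_mul _), integral_const_mul, integral_const_mul,
      hX2, hY2, ← hρ]
    ring
  have hXZ0 : ∫ ω, X ω * Z ω ∂P = 0 := by
    have e : ∀ ω, X ω * Z ω = X ω * Y ω - ρ * X ω ^ 2 := fun ω => by simp only [hZ]; ring
    simp_rw [e]
    rw [integral_sub hXYi (hXL.integrable_sq.const_mul _), integral_const_mul, hX2, ← hρ]
    ring
  have hind : IndepFun X Z P := hXZ.indepFun_of_covariance_eq_zero (by
    rw [covariance_eq_sub hXL hXZ.snd.memLp_two, hX0, zero_mul, sub_zero]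
    exact hXZ0)
  have hZl := map_eq_gaussianReal_of_centred hXZ.snd hZ0
  rw [hZ2] at hZl
  have hv : (1 - ρ ^ 2).toNNReal ≤ 1 := by
    rw [Real.toNNReal_le_one]; nlinarith [sq_nonneg ρ]
  have hXi : ∀ {r : ℝ}, 0 ≤ r → Integrable (fun ω => |X ω| ^ r) P := fun hr =>
    integrable_abs_rpow_of_map hr hXm hX
  have hYi : ∀ {r : ℝ}, 0 ≤ r → Integrable (fun ω => |Y ω| ^ r) P := fun hr =>
    integrable_abs_rpow_of_map hr hYm hY
  have hZi : ∀ {r : ℝ}, 0 ≤ r → Integrable (fun ω => |Z ω| ^ r) P := fun hr =>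
    integrable_abs_rpow_of_map hr hZm hZl
  have hXc : ∫ ω, (|X ω| ^ q - c) ∂P = 0 := by
    rw [integral_sub (hXi hq0) (integrable_const _), integral_abs_rpow_of_map hXm hX]
    simp [hc]
  -- A common majorant of |X|, |Y| and |Z| whose moments are bounded independently of ρ.
  set M : Ω → ℝ := fun ω => |X ω| + |Y ω| + |Z ω| with hM
  have hMb : ∀ {r : ℝ}, 0 ≤ r → Integrable (fun ω => M ω ^ r) P ∧
      ∫ ω, M ω ^ r ∂P ≤ 3 ^ r * (3 * absMoment r) := fun {r} hr => by
    have hdom : Integrable (fun ω => 3 ^ r * (|X ω| ^ r + |Y ω| ^ r + |Z ω| ^ r)) P :=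
      (((hXi hr).add (hYi hr)).add (hZi hr)).const_mul _
    have hle : ∀ ω, M ω ^ r ≤ 3 ^ r * (|X ω| ^ r + |Y ω| ^ r + |Z ω| ^ r) := fun ω =>
      add_add_rpow_le hr (abs_nonneg _) (abs_nonneg _) (abs_nonneg _)
    have hMm : AEMeasurable (fun ω => M ω ^ r) P := by fun_prop
    have hMi : Integrable (fun ω => M ω ^ r) P := hdom.mono' hMm.aestronglyMeasurable
      (.of_forall fun ω => by
        rw [Real.norm_of_nonneg (by positivity)]; exact hle ω)
    refine ⟨hMi, (integral_mono hMi hdom hle).trans ?_⟩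
    have i1 : Integrable (fun ω => |X ω| ^ r + |Y ω| ^ r) P := (hXi hr).add (hYi hr)
    rw [integral_const_mul, integral_add i1 (hZi hr),
      integral_add (hXi hr) (hYi hr)]
    refine mul_le_mul_of_nonneg_left ?_ (by positivity)
    have h1 := integral_abs_rpow_le_absMoment hr hXm le_rfl hX
    have h2 := integral_abs_rpow_le_absMoment hr hYm le_rfl hY
    have h3 := integral_abs_rpow_le_absMoment hr hZm hv hZl
    linarith
  obtain ⟨hM1, hM1'⟩ := hMb hq0
  obtain ⟨hM2, hM2'⟩ := hMb (add_nonneg hq0 hq0)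
  have hpt : ∀ ω, |(|X ω| ^ q - c) * (|Y ω| ^ q - |Z ω| ^ q)|
      ≤ |ρ| * (q * (M ω ^ (q + q) + c * M ω ^ q)) := fun ω => by
    have hM0 : 0 ≤ M ω := by positivity
    have a1 : |X ω| ≤ M ω := by
      simp only [hM]; linarith [abs_nonneg (Y ω), abs_nonneg (Z ω)]
    have a2 : |Y ω| ≤ M ω := by
      simp only [hM]; linarith [abs_nonneg (X ω), abs_nonneg (Z ω)]
    have a3 : |Z ω| ≤ M ω := by
      simp only [hM]; linarith [abs_nonneg (X ω), abs_nonneg (Y ω)]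
    have b1 : |(|X ω| ^ q - c)| ≤ M ω ^ q + c := by
      have := Real.rpow_le_rpow (abs_nonneg _) a1 hq0
      have := Real.rpow_nonneg (abs_nonneg (X ω)) q
      rw [abs_le]; constructor <;> linarith
    have b2 : |(|Y ω| - |Z ω|)| ≤ |ρ| * M ω := by
      refine (abs_abs_sub_abs_le _ _).trans ?_
      have : Y ω - Z ω = ρ * X ω := by simp only [hZ]; ring
      rw [this, abs_mul]
      exact mul_le_mul_of_nonneg_left a1 (abs_nonneg _)
    have b3 : M ω * M ω ^ (q - 1) = M ω ^ q := by
      rcases hM0.eq_or_lt with h0 | h0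
      · rw [← h0, Real.zero_rpow (show q ≠ 0 by positivity), zero_mul]
      · rw [mul_comm, ← Real.rpow_add_one h0.ne']; congr 1; ring
    have b4 : |(|Y ω| ^ q - |Z ω| ^ q)| ≤ q * |ρ| * M ω ^ q := by
      refine (abs_rpow_sub_rpow_le hq (abs_nonneg _) (abs_nonneg _) a2 a3).trans ?_
      rw [← b3, ← mul_assoc, mul_assoc q |ρ|]
      exact mul_le_mul_of_nonneg_right (mul_le_mul_of_nonneg_left b2 hq0)
        (Real.rpow_nonneg hM0 _)
    rw [abs_mul]
    refine (mul_le_mul b1 b4 (abs_nonneg _) (by positivity)).trans (le_of_eq ?_)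
    rw [Real.rpow_add_of_nonneg hM0 hq0 hq0]
    ring
  have hdom : Integrable (fun ω => |ρ| * (q * (M ω ^ (q + q) + c * M ω ^ q))) P :=
    (((hM2.add (hM1.const_mul c)).const_mul q).const_mul _)
  have hi1 : Integrable (fun ω => (|X ω| ^ q - c) * (|Y ω| ^ q - |Z ω| ^ q)) P :=
    hdom.mono' (by fun_prop) (.of_forall hpt)
  have hi2 : Integrable (fun ω => (|X ω| ^ q - c) * (|Z ω| ^ q - c)) P :=
    IndepFun.integrable_mul (X := fun ω => |X ω| ^ q - c) (Y := fun ω => |Z ω| ^ q - c)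
      (hind.comp (φ := fun y => |y| ^ q - c) (ψ := fun y => |y| ^ q - c)
      (by fun_prop) (by fun_prop)) ((hXi hq0).sub (integrable_const _))
      ((hZi hq0).sub (integrable_const _))
  have hi3 : ∫ ω, (|X ω| ^ q - c) * (|Z ω| ^ q - c) ∂P = 0 := by
    have := IndepFun.integral_fun_mul_eq_mul_integral
      (hind.comp (φ := fun y => |y| ^ q - c) (ψ := fun y => |y| ^ q - c)
      (by fun_prop) (by fun_prop)) (by fun_prop) (by fun_prop)
    simp only [Function.comp_apply] at this
    rw [this, hXc, zero_mul]
  have hsplit : ∫ ω, (|X ω| ^ q - c) * (|Y ω| ^ q - c) ∂P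
      = ∫ ω, (|X ω| ^ q - c) * (|Y ω| ^ q - |Z ω| ^ q) ∂P := by
    rw [← add_zero (∫ ω, (|X ω| ^ q - c) * (|Y ω| ^ q - |Z ω| ^ q) ∂P), ← hi3,
      ← integral_add hi1 hi2]
    exact integral_congr_ae (.of_forall fun ω => by ring)
  rw [hsplit]
  refine (abs_integral_le_integral_abs.trans (integral_mono hi1.abs hdom hpt)).trans ?_
  rw [integral_const_mul, integral_const_mul, integral_add hM2 (hM1.const_mul c),
    integral_const_mul, mul_comm]
  refine mul_le_mul_of_nonneg_right (mul_le_mul_of_nonneg_left ?_ hq0) (abs_nonneg _)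
  exact add_le_add hM2' (mul_le_mul_of_nonneg_left hM1' hc0)

end GaussianMoments

/-! ### Second moments of integrated processes; almost sure consequences. -/

section SecondMoment

variable {T Ω : Type*} [MeasurableSpace T] [MeasurableSpace Ω] {μ : Measure T} {P : Measure Ω}

/-- Meant for the two projections T × T → T, which push the product measure forward to μ(T) • μ;
hence the scalar `c`. -/
lemma memLp_two_comp_prodMap [SFinite P] {S : Type*} [MeasurableSpace S] {κ : Measure S} {g : S → T}
    {c : ℝ≥0∞} (hc : c ≠ ∞) (hg : Measurable g) (hκ : κ.map g = c • μ) [SFinite κ]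
    {Y : T × Ω → ℝ} (hY : MemLp Y 2 (μ.prod P)) :
    MemLp (fun z : S × Ω => Y (g z.1, z.2)) 2 (κ.prod P) := by
  have hmap : (κ.prod P).map (Prod.map g id) = c • μ.prod P := by
    rw [← Measure.map_prod_map _ _ hg measurable_id, Measure.map_id, hκ, Measure.prod_smul_left]
  have h : MemLp Y 2 ((κ.prod P).map (Prod.map g id)) := by
    rw [hmap]; exact hY.smul_measure hc
  exact (memLp_map_measure_iff h.aestronglyMeasurable
    (hg.prodMap measurable_id).aemeasurable).1 h

/-- The second moment of the integral of a square integrable process is at most the integral of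
the absolute values of its correlations. -/
lemma lintegral_enorm_sq_integral_le [IsFiniteMeasure μ] [IsProbabilityMeasure P] {Y : T × Ω → ℝ} (hY : MemLp Y 2 (μ.prod P)) :
    ∫⁻ ω, ‖∫ r, Y (r, ω) ∂μ‖ₑ ^ 2 ∂P
      ≤ ∫⁻ r, ∫⁻ r', ‖∫ ω, Y (r, ω) * Y (r', ω) ∂P‖ₑ ∂μ ∂μ := by
  have h1 := memLp_two_comp_prodMap (κ := μ.prod μ) (measure_ne_top μ univ) measurable_fst
    Measure.map_fst_prod hY
  have h2 := memLp_two_comp_prodMap (κ := μ.prod μ) (measure_ne_top μ univ) measurable_snd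
    Measure.map_snd_prod hY
  have hF : Integrable (fun z : (T × T) × Ω => Y (z.1.1, z.2) * Y (z.1.2, z.2))
      ((μ.prod μ).prod P) := h1.integrable_mul h2
  -- The squared integral is a double integral, after which Fubini exchanges it with the
  -- expectation.
  have hsq : ∀ ω, ∫ z : T × T, Y (z.1, ω) * Y (z.2, ω) ∂(μ.prod μ) = (∫ r, Y (r, ω) ∂μ) ^ 2 :=
    fun ω => by
      rw [sq]
      exact integral_prod_mul (fun r => Y (r, ω)) (fun r => Y (r, ω))
  have hG : Integrable (fun ω => (∫ r, Y (r, ω) ∂μ) ^ 2) P := by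
    simp_rw [← hsq]; exact hF.integral_prod_right
  calc ∫⁻ ω, ‖∫ r, Y (r, ω) ∂μ‖ₑ ^ 2 ∂P
      = ∫⁻ ω, ENNReal.ofReal ((∫ r, Y (r, ω) ∂μ) ^ 2) ∂P := by
        refine lintegral_congr fun ω => ?_
        rw [← enorm_pow, Real.enorm_of_nonneg (sq_nonneg _)]
    _ = ENNReal.ofReal (∫ ω, (∫ r, Y (r, ω) ∂μ) ^ 2 ∂P) :=
        (ofReal_integral_eq_lintegral_ofReal hG (.of_forall fun _ => sq_nonneg _)).symm
    _ = ENNReal.ofReal (∫ z : T × T, ∫ ω, Y (z.1, ω) * Y (z.2, ω) ∂P ∂(μ.prod μ)) := by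
        simp_rw [← hsq]
        rw [← integral_prod_symm _ hF, integral_prod _ hF]
    _ ≤ ‖∫ z : T × T, ∫ ω, Y (z.1, ω) * Y (z.2, ω) ∂P ∂(μ.prod μ)‖ₑ :=
        Real.ofReal_le_enorm _
    _ ≤ ∫⁻ z : T × T, ‖∫ ω, Y (z.1, ω) * Y (z.2, ω) ∂P‖ₑ ∂(μ.prod μ) :=
        enorm_integral_le_lintegral_enorm _
    _ = _ := lintegral_prod _ hF.integral_prod_left.aestronglyMeasurable.enorm

lemma memLp_of_lintegral_le [IsFiniteMeasure μ] [SFinite P] {p : ℝ≥0∞} (hp0 : p ≠ 0)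
    (hp : p ≠ ∞) {Y : T × Ω → ℝ} (hY : AEStronglyMeasurable Y (μ.prod P))
    {B : ℝ≥0∞} (hB : B ≠ ∞) (h : ∀ᵐ r ∂μ, ∫⁻ ω, ‖Y (r, ω)‖ₑ ^ p.toReal ∂P ≤ B) :
    MemLp Y p (μ.prod P) := by
  refine ⟨hY, ?_⟩
  rw [eLpNorm_lt_top_iff_lintegral_rpow_enorm_lt_top hp0 hp,
    lintegral_prod _ (hY.enorm.pow_const _)]
  refine (lintegral_mono_ae h).trans_lt ?_
  rw [lintegral_const]
  exact ENNReal.mul_lt_top hB.lt_top (measure_lt_top _ _)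

lemma MemLp.ae_memLp_section [SFinite μ] [SFinite P] {p : ℝ≥0∞} (hp0 : p ≠ 0) (hp : p ≠ ∞)
    {Y : T × Ω → ℝ} (hY : MemLp Y p (μ.prod P)) :
    ∀ᵐ ω ∂P, MemLp (fun r => Y (r, ω)) p μ := by
  have hs : AEStronglyMeasurable (fun z : Ω × T => Y z.swap) (P.prod μ) :=
    hY.aestronglyMeasurable.prod_swap
  have hfin : ∫⁻ ω, ∫⁻ r, ‖Y (r, ω)‖ₑ ^ p.toReal ∂μ ∂P ≠ ∞ := by
    rw [← lintegral_prod_symm _ (hY.aestronglyMeasurable.enorm.pow_const _)]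
    exact ((eLpNorm_lt_top_iff_lintegral_rpow_enorm_lt_top hp0 hp).1 hY.eLpNorm_lt_top).ne
  have hm : AEMeasurable (fun ω => ∫⁻ r, ‖Y (r, ω)‖ₑ ^ p.toReal ∂μ) P :=
    (hs.enorm.pow_const p.toReal).lintegral_prod_right'
  filter_upwards [ae_lt_top' hm hfin, hs.prodMk_left] with ω h1 h2
  exact ⟨h2, (eLpNorm_lt_top_iff_lintegral_rpow_enorm_lt_top hp0 hp).2 h1⟩

/-- The series of squares has finite expectation, so it converges almost surely and its terms tend
to 0. -/
lemma ae_tendsto_zero_of_tsum_lintegral {Z : ℕ → Ω → ℝ} (hZ : ∀ n, AEStronglyMeasurable (Z n) P)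
    (h : ∑' n, ∫⁻ ω, ‖Z n ω‖ₑ ^ 2 ∂P ≠ ∞) : ∀ᵐ ω ∂P, Tendsto (fun n => Z n ω) atTop (𝓝 0) := by
  have hm : ∀ n, AEMeasurable (fun ω => ‖Z n ω‖ₑ ^ 2) P := fun n => (hZ n).enorm.pow_const 2
  rw [← lintegral_tsum hm] at h
  filter_upwards [ae_lt_top' (AEMeasurable.tsum hm) h] with ω hω
  have h0 := ENNReal.tendsto_atTop_zero_of_tsum_ne_top hω.ne
  have h1 : Tendsto (fun n => ‖Z n ω‖ ^ 2) atTop (𝓝 0) := by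
    have := (ENNReal.tendsto_toReal ENNReal.zero_ne_top).comp h0
    simpa [Function.comp_def] using this
  rw [tendsto_zero_iff_norm_tendsto_zero]
  simpa [Real.sqrt_sq_eq_abs] using h1.sqrt

end SecondMoment

/-- For r, r' in [0, 1] the difference lies in [-1, 1], so the integral of |v|^{-1/2} over [-1, 1]
serves for every r. -/
lemma lintegral_inv_sqrt_abs_sub_le :
    ∃ D : ℝ≥0∞, D ≠ ∞ ∧ ∀ r ∈ Icc (0 : ℝ) 1,
      ∫⁻ r' in Icc (0 : ℝ) 1, ENNReal.ofReal (√|r - r'|)⁻¹ ≤ D := by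
  refine ⟨∫⁻ v in Icc (-1 : ℝ) 1, ENNReal.ofReal (√|v|)⁻¹, ?_, fun r hr => ?_⟩
  · have h0 : IntegrableOn (fun v : ℝ => (√|v|)⁻¹) (Ioc 0 1) := by
      have := (intervalIntegral.intervalIntegrable_rpow' (a := 0) (b := 1)
        (r := -(1 / 2)) (by norm_num)).1
      refine this.congr_fun (fun v hv => ?_) measurableSet_Ioc
      simp only
      rw [abs_of_pos hv.1, Real.sqrt_eq_rpow, Real.rpow_neg hv.1.le]
    have h1 : IntervalIntegrable (fun v : ℝ => (√|v|)⁻¹) volume 0 1 :=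
      (intervalIntegrable_iff_integrableOn_Ioc_of_le zero_le_one).2 h0
    have h2 : IntervalIntegrable (fun v : ℝ => (√|v|)⁻¹) volume 0 (-1) := by
      have := (IntervalIntegrable.iff_comp_neg (f := fun v : ℝ => (√|v|)⁻¹)).1 h1
      simpa using this
    have h3 := (h2.symm.trans h1)
    rw [intervalIntegrable_iff_integrableOn_Icc_of_le (by norm_num)] at h3
    exact h3.lintegral_lt_top.ne
  · have e : ∀ r', (Icc (0 : ℝ) 1).indicator (fun r' => ENNReal.ofReal (√|r - r'|)⁻¹) r'
        ≤ (Icc (-1 : ℝ) 1).indicator (fun v => ENNReal.ofReal (√|v|)⁻¹) (r - r') := fun r' => by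
      by_cases h : r' ∈ Icc (0 : ℝ) 1
      · rw [indicator_of_mem h, indicator_of_mem]
        exact ⟨by linarith [hr.1, h.2], by linarith [hr.2, h.1]⟩
      · rw [indicator_of_notMem h]; exact zero_le
    rw [← lintegral_indicator measurableSet_Icc, ← lintegral_indicator measurableSet_Icc]
    exact (lintegral_mono e).trans_eq (lintegral_sub_left_eq_self _ r)

/-! ### Normalised increments and the law of large numbers. -/

section NormalisedIncrements

variable {Ω : Type*} [MeasurableSpace Ω] {P : Measure Ω} {W : ℝ≥0 × BddBorel → Ω → ℝ}
  {u : ℝ → ℝ → Ω → ℝ}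

/-- The standard deviation of `u (r + h) x - u r x`. -/
noncomputable def incrStd (h r : ℝ) : ℝ := √(incrCov h r r)

lemma sq_le_incrStd {h r : ℝ} (hh : 0 ≤ h) (hr : 0 ≤ r) : √(kappa * √h) ≤ incrStd h r :=
  Real.sqrt_le_sqrt (le_incrCov_diag hh hr)

lemma incrStd_le {h r : ℝ} (hh : 0 ≤ h) (hr : 0 ≤ r) : incrStd h r ≤ √(3 * kappa * √h) :=
  Real.sqrt_le_sqrt (incrCov_diag_le hh hr)

lemma incrCov_diag_pos {h r : ℝ} (hh : 0 < h) (hr : 0 ≤ r) : 0 < incrCov h r r :=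
  (mul_pos kappa_pos (Real.sqrt_pos.2 hh)).trans_le (le_incrCov_diag hh.le hr)

lemma incrStd_pos {h r : ℝ} (hh : 0 < h) (hr : 0 ≤ r) : 0 < incrStd h r :=
  Real.sqrt_pos.2 (incrCov_diag_pos hh hr)

lemma continuous_incrStd (h : ℝ) : Continuous (incrStd h) := (continuous_incrCov_diag h).sqrt

/-- The increment `u (r + h) x - u r x`, normalised to have variance one. -/
noncomputable def normIncr (u : ℝ → ℝ → Ω → ℝ) (x h r : ℝ) (ω : Ω) : ℝ :=
  (incrStd h r)⁻¹ * (u (r + h) x ω - u r x ω)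

lemma IsMildSolution.integral_normIncr_mul (hW : IsWhiteNoise P W) (hu : IsMildSolution P W u)
    {h r r' : ℝ} (hh : 0 ≤ h) (hr : 0 ≤ r) (hr' : 0 ≤ r') (x : ℝ) :
    ∫ ω, normIncr u x h r ω * normIncr u x h r' ω ∂P
      = (incrStd h r * incrStd h r')⁻¹ * incrCov h r r' := by
  rw [← hu.integral_increment_mul hW hh hr hr' x, ← integral_const_mul]
  refine integral_congr_ae (.of_forall fun ω => ?_)
  simp only [normIncr, mul_inv]
  ring

lemma IsMildSolution.map_normIncr [IsProbabilityMeasure P] (hW : IsWhiteNoise P W)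
    (hu : IsMildSolution P W u) {h r : ℝ} (hh : 0 < h) (hr : 0 ≤ r) (x : ℝ) :
    P.map (normIncr u x h r) = gaussianReal 0 1 := by
  have h1 := ((hu.isWienerIntegral_increment hW hh.le hr x).const_mul
    (incrStd h r)⁻¹).map_eq_gaussianReal hW
  have h2 := hu.integral_normIncr_mul hW hh.le hr hr x
  have h3 : incrStd h r * incrStd h r = incrCov h r r :=
    Real.mul_self_sqrt (incrCov_diag_pos hh hr).le
  rw [h3, inv_mul_cancel₀ (incrCov_diag_pos hh hr).ne'] at h2
  simp_rw [← sq] at h2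
  unfold normIncr at h2 ⊢
  rw [h1, h2, Real.toNNReal_one]

lemma IsMildSolution.hasGaussianLaw_normIncr [IsProbabilityMeasure P] (hW : IsWhiteNoise P W)
    (hu : IsMildSolution P W u) {h r r' : ℝ} (hh : 0 ≤ h) (hr : 0 ≤ r) (hr' : 0 ≤ r') (x : ℝ) :
    HasGaussianLaw (fun ω => (normIncr u x h r ω, normIncr u x h r' ω)) P :=
  ((hu.isWienerIntegral_increment hW hh hr x).const_mul _).hasGaussianLaw_prodMk hW
    ((hu.isWienerIntegral_increment hW hh hr' x).const_mul _)

/-- The covariance is O(h |r - r'|^{-1/2}) while both standard deviations are at least of order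
h^{1/4}; dividing leaves a gain of √h. -/
lemma IsMildSolution.abs_integral_normIncr_mul_le (hW : IsWhiteNoise P W)
    (hu : IsMildSolution P W u) {h r r' : ℝ} (hh : 0 < h) (hr : 0 ≤ r) (hr' : 0 ≤ r')
    (hne : r ≠ r') (x : ℝ) :
    |∫ ω, normIncr u x h r ω * normIncr u x h r' ω ∂P| ≤ 4 * √h * (√|r - r'|)⁻¹ := by
  have hs := Real.sqrt_pos.2 hh
  have hk := mul_pos kappa_pos hs
  have h1 : kappa * √h ≤ incrStd h r * incrStd h r' := by
    rw [← Real.mul_self_sqrt hk.le]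
    exact mul_le_mul (sq_le_incrStd hh.le hr) (sq_le_incrStd hh.le hr') (Real.sqrt_nonneg _)
      (Real.sqrt_nonneg _)
  have h2 := abs_incrCov_le hh.le hr hr' hne
  rw [hu.integral_normIncr_mul hW hh.le hr hr' x, abs_mul, abs_inv,
    abs_of_pos (hk.trans_le h1)]
  calc (incrStd h r * incrStd h r')⁻¹ * |incrCov h r r'|
      ≤ (kappa * √h)⁻¹ * (4 * kappa * h / √|r - r'|) :=
        mul_le_mul (inv_anti₀ hk h1) h2 (abs_nonneg _) (inv_nonneg.2 hk.le)
    _ = 4 * √h * (√|r - r'|)⁻¹ := by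
        have hkp := kappa_pos.ne'
        rw [div_eq_mul_inv]
        nth_rewrite 2 [← Real.mul_self_sqrt hh.le]
        field_simp

/-- Joint measurability holds only up to null sets, so the time change must pull null sets back to
null sets. -/
lemma IsMildSolution.aestronglyMeasurable_comp [IsProbabilityMeasure P]
    (hu : IsMildSolution P W u) (x : ℝ) {μ : Measure ℝ} [SFinite μ] {f : ℝ → ℝ}
    (hf : Measure.QuasiMeasurePreserving f μ (volume.restrict (Ici 0))) :
    AEStronglyMeasurable (fun z : ℝ × Ω => u (f z.1) x z.2) (μ.prod P) := by
  refine (hu.aestronglyMeasurable x).comp_quasiMeasurePreserving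
    (f := Prod.map f id) ⟨hf.measurable.prodMap measurable_id, ?_⟩
  rw [← Measure.map_prod_map _ _ hf.measurable measurable_id, Measure.map_id]
  exact hf.absolutelyContinuous.prod Measure.AbsolutelyContinuous.rfl

lemma quasiMeasurePreserving_add_const {h : ℝ} (hh : 0 ≤ h) :
    Measure.QuasiMeasurePreserving (fun r => r + h) (volume.restrict (Icc (0 : ℝ) (1 - h)))
      (volume.restrict (Ici 0)) :=
  (measurePreserving_add_right volume h).quasiMeasurePreserving.restrict
    fun _ hr => add_nonneg hr.1 hh

lemma IsMildSolution.aestronglyMeasurable_increment [IsProbabilityMeasure P]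
    (hu : IsMildSolution P W u) (x : ℝ) {h : ℝ} (hh : 0 ≤ h) :
    AEStronglyMeasurable (fun z : ℝ × Ω => u (z.1 + h) x z.2 - u z.1 x z.2)
      ((volume.restrict (Icc 0 (1 - h))).prod P) := by
  refine (hu.aestronglyMeasurable_comp x (quasiMeasurePreserving_add_const hh)).sub ?_
  exact hu.aestronglyMeasurable_comp x (f := id)
    ((MeasurePreserving.id volume).quasiMeasurePreserving.restrict fun _ hr => hr.1)

lemma IsMildSolution.aestronglyMeasurable_normIncr [IsProbabilityMeasure P]
    (hu : IsMildSolution P W u) (x : ℝ) {h : ℝ} (hh : 0 ≤ h) :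
    AEStronglyMeasurable (fun z : ℝ × Ω => normIncr u x h z.1 z.2)
      ((volume.restrict (Icc 0 (1 - h))).prod P) := by
  have hm : Measurable fun z : ℝ × Ω => (incrStd h z.1)⁻¹ :=
    ((continuous_incrStd h).measurable.comp measurable_fst).inv
  exact hm.aestronglyMeasurable.mul (hu.aestronglyMeasurable_increment x hh)

lemma lintegral_enorm_sq_centred_abs_rpow_ne_top {q : ℝ} (hq : 0 ≤ q) (c : ℝ) :
    ∫⁻ y, ‖|y| ^ q - c‖ₑ ^ 2 ∂gaussianReal 0 1 ≠ ∞ := by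
  have h1 := integrable_abs_rpow_gaussianReal hq 1
  have h2 := integrable_abs_rpow_gaussianReal (add_nonneg hq hq) 1
  have h3 : Integrable (fun y : ℝ => (|y| ^ q - c) ^ 2) (gaussianReal 0 1) := by
    refine ((h2.sub (h1.const_mul (2 * c))).add (integrable_const (c ^ 2))).congr
      (.of_forall fun y => ?_)
    simp only [Pi.add_apply, Pi.sub_apply]
    rw [Real.rpow_add_of_nonneg (abs_nonneg y) hq hq]
    ring
  have := h3.hasFiniteIntegral.ne
  simpa only [enorm_pow] using this

variable [IsProbabilityMeasure P]

/-- The centred `q`-th absolute power of the normalised increments. -/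
noncomputable def centredPow (u : ℝ → ℝ → Ω → ℝ) (x q h : ℝ) (z : ℝ × Ω) : ℝ :=
  |normIncr u x h z.1 z.2| ^ q - absMoment q

lemma IsMildSolution.memLp_centredPow (hW : IsWhiteNoise P W) (hu : IsMildSolution P W u)
    (x : ℝ) {q h : ℝ} (hq : 0 ≤ q) (hh : 0 < h) :
    MemLp (centredPow u x q h) 2 ((volume.restrict (Icc 0 (1 - h))).prod P) := by
  have hm : Measurable fun y : ℝ => |y| ^ q - absMoment q := by fun_prop
  refine memLp_of_lintegral_le (by norm_num) (by norm_num)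
    (B := ∫⁻ y, ‖|y| ^ q - absMoment q‖ₑ ^ 2 ∂gaussianReal 0 1)
    ?_ (lintegral_enorm_sq_centred_abs_rpow_ne_top hq _) ?_
  · exact (hm.comp_aemeasurable
      (hu.aestronglyMeasurable_normIncr x hh.le).aemeasurable).aestronglyMeasurable
  · refine ae_restrict_of_forall_mem measurableSet_Icc fun r hr => le_of_eq ?_
    have hl := hu.map_normIncr hW hh hr.1 x
    simp only [ENNReal.toReal_ofNat, ENNReal.rpow_ofNat]
    rw [← hl, lintegral_map' (by fun_prop)
      (hu.hasGaussianLaw_normIncr hW hh.le hr.1 hr.1 x).fst.aemeasurable]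
    rfl

/-- The fluctuations of `∫ |normIncr|^q` over `[0, 1 - h]` are of order `h^{1/4}` in `L²`. -/
lemma IsMildSolution.exists_lintegral_enorm_sq_centredPow_le (hW : IsWhiteNoise P W)
    (hu : IsMildSolution P W u) (x : ℝ) {q : ℝ} (hq : 1 ≤ q) :
    ∃ K : ℝ≥0∞, K ≠ ∞ ∧ ∀ h : ℝ, 0 < h →
      ∫⁻ ω, ‖∫ r in Icc 0 (1 - h), centredPow u x q h (r, ω)‖ₑ ^ 2 ∂P
        ≤ K * ENNReal.ofReal √h := by
  obtain ⟨C, hC0, hC⟩ := exists_abs_integral_centred_abs_rpow_mul_le (P := P) hq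
  obtain ⟨D, hD, hDle⟩ := lintegral_inv_sqrt_abs_sub_le
  refine ⟨ENNReal.ofReal (4 * C) * D, ENNReal.mul_ne_top ENNReal.ofReal_ne_top hD,
    fun h hh => ?_⟩
  have hsub : Icc (0 : ℝ) (1 - h) ⊆ Icc 0 1 := Icc_subset_Icc_right (by linarith)
  refine (lintegral_enorm_sq_integral_le
    (hu.memLp_centredPow hW x (zero_le_one.trans hq) hh)).trans ?_
  have hinner : ∀ r ∈ Icc (0 : ℝ) (1 - h), ∫⁻ r' in Icc 0 (1 - h),
      ‖∫ ω, centredPow u x q h (r, ω) * centredPow u x q h (r', ω) ∂P‖ₑ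
        ≤ ENNReal.ofReal (4 * C) * D * ENNReal.ofReal √h := fun r hr => by
    have hae : ∀ᵐ r' ∂(volume.restrict (Icc (0 : ℝ) (1 - h))),
        ‖∫ ω, centredPow u x q h (r, ω) * centredPow u x q h (r', ω) ∂P‖ₑ
          ≤ ENNReal.ofReal (4 * C * √h) * ENNReal.ofReal (√|r - r'|)⁻¹ := by
      -- The correlation bound fails to apply on the diagonal, which is null.
      have hne : ∀ᵐ r' ∂(volume.restrict (Icc (0 : ℝ) (1 - h))), r' ≠ r :=
        ae_restrict_of_ae (by simp [ae_iff])
      filter_upwards [hne, ae_restrict_mem measurableSet_Icc] with r' hrr hr'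
      rw [← ENNReal.ofReal_mul (by positivity), Real.enorm_eq_ofReal_abs]
      refine ENNReal.ofReal_le_ofReal ?_
      refine (hC _ _ (hu.hasGaussianLaw_normIncr hW hh.le hr.1 hr'.1 x)
        (hu.map_normIncr hW hh hr.1 x) (hu.map_normIncr hW hh hr'.1 x)).trans ?_
      refine (mul_le_mul_of_nonneg_left
        (hu.abs_integral_normIncr_mul_le hW hh hr.1 hr'.1 hrr.symm x) hC0).trans (le_of_eq ?_)
      ring
    refine (lintegral_mono_ae hae).trans ?_
    rw [lintegral_const_mul' _ _ ENNReal.ofReal_ne_top, ENNReal.ofReal_mul (by positivity),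
      mul_right_comm]
    refine mul_le_mul_left ?_ _
    exact mul_le_mul_right ((lintegral_mono_set hsub).trans (hDle r (hsub hr))) _
  refine (setLIntegral_mono' measurableSet_Icc hinner).trans ?_
  rw [setLIntegral_const]
  refine mul_le_of_le_one_right' ?_
  rw [Real.volume_Icc, ENNReal.ofReal_le_one]
  linarith

/-- Along `h = 2^{-n}`, the averages `∫ |normIncr|^q` converge almost surely. -/
lemma IsMildSolution.ae_tendsto_setIntegral_centredPow (hW : IsWhiteNoise P W)
    (hu : IsMildSolution P W u) (x : ℝ) {q : ℝ} (hq : 1 ≤ q) :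
    ∀ᵐ ω ∂P, Tendsto (fun n : ℕ => ∫ r in Icc 0 (1 - (1 / 2 : ℝ) ^ n),
      centredPow u x q ((1 / 2 : ℝ) ^ n) (r, ω)) atTop (𝓝 0) := by
  obtain ⟨K, hK, hle⟩ := hu.exists_lintegral_enorm_sq_centredPow_le hW x hq
  have hpos : ∀ n : ℕ, 0 < (1 / 2 : ℝ) ^ n := fun n => by positivity
  refine ae_tendsto_zero_of_tsum_lintegral (fun n => ?_) ?_
  · exact (hu.memLp_centredPow hW x (zero_le_one.trans hq)
      (hpos n)).aestronglyMeasurable.prod_swap.integral_prod_right'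
  · refine ne_top_of_le_ne_top ?_ (ENNReal.tsum_le_tsum fun n => hle _ (hpos n))
    rw [ENNReal.tsum_mul_left]
    refine ENNReal.mul_ne_top hK ?_
    -- The second moments are dominated by a geometric series of ratio √(1/2).
    have e : ∀ n : ℕ, √((1 / 2 : ℝ) ^ n) = √(1 / 2 : ℝ) ^ n := fun n => by
      rw [Real.sqrt_eq_iff_mul_self_eq (by positivity) (by positivity), ← mul_pow,
        Real.mul_self_sqrt (by norm_num)]
    simp_rw [e]
    refine (summable_geometric_of_lt_one (Real.sqrt_nonneg _) ?_).tsum_ofReal_ne_top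
    rw [Real.sqrt_lt' one_pos]
    norm_num

end NormalisedIncrements

/-! ### From dyadic shifts to all shifts. -/

section Dyadic

/-- A subadditive function on `[0, 1]` that vanishes at `0+` and is of order `s^α` at the dyadic
numbers `2^{-n}` is of order `s^α` everywhere. -/
lemma le_of_subadditive_of_dyadic {N : ℝ → ℝ≥0∞} {α : ℝ} (hα : 0 < α) {K : ℝ≥0∞}
    (hsub : ∀ s s', 0 ≤ s → 0 ≤ s' → s + s' ≤ 1 → N (s + s') ≤ N s + N s')
    (hdy : ∀ n : ℕ, N ((1 / 2 : ℝ) ^ n) ≤ K * ENNReal.ofReal (((1 / 2 : ℝ) ^ n) ^ α))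
    (h0 : Tendsto N (𝓝[≥] 0) (𝓝 0)) {s : ℝ} (hs0 : 0 ≤ s) (hs1 : s ≤ 1) :
    N s ≤ K * ENNReal.ofReal (s ^ α / (1 - (1 / 2) ^ α)) := by
  set θ : ℝ := (1 / 2) ^ α with hθ
  have hθ1 : θ < 1 := Real.rpow_lt_one (by norm_num) (by norm_num) hα
  have hθ' : 0 < 1 - θ := sub_pos.2 hθ1
  -- Greedy binary expansion: m dyadic pieces are removed, leaving a remainder of at most 2^{-m} s.
  have key : ∀ m : ℕ, ∀ s : ℝ, 0 ≤ s → s ≤ 1 → ∃ s', 0 ≤ s' ∧ s' ≤ (1 / 2) ^ m * s ∧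
      N s ≤ K * ENNReal.ofReal (s ^ α / (1 - θ)) + N s' := by
    intro m
    induction m with
    | zero => exact fun s hs _ => ⟨s, hs, by simp, le_add_self⟩
    | succ m ih =>
      intro s hs hs1
      rcases hs.eq_or_lt with rfl | hspos
      · exact ⟨0, le_rfl, by simp, le_add_self⟩
      -- This gives a = 2^{-(n+1)} with a < s ≤ 2a, so the remainder s - a is at most s/2 and (s -
      -- a)^α ≤ θ s^α. The bound closes since 1 + θ/(1 - θ) = 1/(1 - θ).
      obtain ⟨n, hn, hn'⟩ := exists_nat_pow_near_of_lt_one hspos hs1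
        (by norm_num : (0 : ℝ) < 1 / 2) (by norm_num)
      set a : ℝ := (1 / 2) ^ (n + 1) with ha
      have ha0 : 0 < a := by positivity
      have hsa : s ≤ 2 * a := by rw [ha, pow_succ]; linarith
      obtain ⟨s', h1, h2, h3⟩ := ih (s - a) (by linarith) (by linarith)
      refine ⟨s', h1, h2.trans ?_, ?_⟩
      · rw [pow_succ, mul_assoc]
        exact mul_le_mul_of_nonneg_left (by linarith) (by positivity)
      · have e : N s ≤ N a + N (s - a) := by
          have := hsub a (s - a) ha0.le (by linarith) (by linarith)
          rwa [add_sub_cancel] at this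
        refine e.trans ((add_le_add (hdy (n + 1)) h3).trans ?_)
        rw [← add_assoc, ← mul_add, ← ENNReal.ofReal_add (by positivity)
          (div_nonneg (Real.rpow_nonneg (by linarith) _) hθ'.le)]
        gcongr
        have e1 : a ^ α ≤ s ^ α := Real.rpow_le_rpow ha0.le hn.le hα.le
        have e2 : (s - a) ^ α ≤ θ * s ^ α := by
          rw [hθ, ← Real.mul_rpow (by norm_num) hs]
          exact Real.rpow_le_rpow (by linarith) (by linarith) hα.le
        rw [← ha, le_div_iff₀ hθ', add_mul, div_mul_cancel₀ _ hθ'.ne']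
        nlinarith
  choose s' h1 h2 h3 using fun m => key m s hs0 hs1
  have hlim : Tendsto (fun m : ℕ => (1 / 2 : ℝ) ^ m * s) atTop (𝓝 0) := by
    simpa using (tendsto_pow_atTop_nhds_zero_of_lt_one (by norm_num : (0 : ℝ) ≤ 1 / 2)
      (by norm_num)).mul_const s
  have hs' : Tendsto s' atTop (𝓝[≥] 0) := tendsto_nhdsWithin_iff.2
    ⟨tendsto_of_tendsto_of_tendsto_of_le_of_le tendsto_const_nhds hlim h1 h2,
      .of_forall h1⟩
  have hN : Tendsto (fun m => K * ENNReal.ofReal (s ^ α / (1 - θ)) + N (s' m)) atTop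
      (𝓝 (K * ENNReal.ofReal (s ^ α / (1 - θ)))) := by
    simpa using (h0.comp hs').const_add (K * ENNReal.ofReal (s ^ α / (1 - θ)))
  exact ge_of_tendsto' hN h3

end Dyadic

/-! ### Increments in L^p and the Besov conditions. -/

section Translation

/-- The `L^p` norm over `[0, 1 - s]` of the increment `f (· + s) - f`. -/
noncomputable def incrNorm (p : ℝ≥0∞) (f : ℝ → ℝ) (s : ℝ) : ℝ≥0∞ :=
  eLpNorm (fun r => f (r + s) - f r) p (volume.restrict (Icc 0 (1 - s)))

variable {p : ℝ≥0∞} {f : ℝ → ℝ}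

lemma eLpNorm_comp_add_right (g : ℝ → ℝ) (a b s : ℝ) :
    eLpNorm (fun r => g (r + s)) p (volume.restrict (Icc a b))
      = eLpNorm g p (volume.restrict (Icc (a + s) (b + s))) := by
  have hemb : MeasurableEmbedding fun r : ℝ => r + s := measurableEmbedding_addRight s
  have hmp := (measurePreserving_add_right (volume : Measure ℝ) s).restrict_preimage_emb hemb
    (Icc (a + s) (b + s))
  have hpre : (fun r => r + s) ⁻¹' Icc (a + s) (b + s) = Icc a b := by
    ext r; simp
  rw [hpre] at hmp
  rw [← hmp.map_eq, hemb.eLpNorm_map_measure]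
  rfl

lemma aestronglyMeasurable_comp_add (hf : AEStronglyMeasurable f (volume.restrict (Icc 0 1)))
    {a b s : ℝ} (ha : 0 ≤ a + s) (hb : b + s ≤ 1) :
    AEStronglyMeasurable (fun r => f (r + s)) (volume.restrict (Icc a b)) :=
  hf.comp_quasiMeasurePreserving
    ((measurePreserving_add_right volume s).quasiMeasurePreserving.restrict
      fun _ hr => ⟨ha.trans (by simpa using hr.1), le_trans (by simpa using hr.2) hb⟩)

/-- Pass through the intermediate point r + s. The second difference is a translate by s of an
increment of length s', and both remain within their domains of integration. -/
lemma incrNorm_add_le (hp : 1 ≤ p) (hf : AEStronglyMeasurable f (volume.restrict (Icc 0 1)))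
    {s s' : ℝ} (hs : 0 ≤ s) (hs' : 0 ≤ s') :
    incrNorm p f (s + s') ≤ incrNorm p f s + incrNorm p f s' := by
  have m0 : AEStronglyMeasurable (fun r => f r) (volume.restrict (Icc 0 (1 - (s + s')))) := by
    simpa using aestronglyMeasurable_comp_add hf (a := 0) (b := 1 - (s + s')) (s := 0)
      (by simp) (by linarith)
  have m1 := aestronglyMeasurable_comp_add hf (a := 0) (b := 1 - (s + s')) (s := s)
    (by linarith) (by linarith)
  have m2 := aestronglyMeasurable_comp_add hf (a := 0) (b := 1 - (s + s')) (s := s + s')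
    (by linarith) (by linarith)
  calc incrNorm p f (s + s')
      = eLpNorm ((fun r => f (r + s) - f r) + fun r => f (r + (s + s')) - f (r + s)) p
          (volume.restrict (Icc 0 (1 - (s + s')))) := by
        unfold incrNorm; congr 1; ext r; simp
    _ ≤ eLpNorm (fun r => f (r + s) - f r) p (volume.restrict (Icc 0 (1 - (s + s'))))
        + eLpNorm (fun r => f (r + (s + s')) - f (r + s)) p
          (volume.restrict (Icc 0 (1 - (s + s')))) :=
        eLpNorm_add_le (m1.sub m0) (m2.sub m1) hp
    _ ≤ incrNorm p f s + incrNorm p f s' := by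
        gcongr
        · exact eLpNorm_mono_measure _ (Measure.restrict_mono
            (Icc_subset_Icc_right (by linarith)) le_rfl)
        · simp_rw [← add_assoc, fun r => add_right_comm r s s']
          have := eLpNorm_comp_add_right (p := p) (fun r => f (r + s') - f r) 0 (1 - (s + s')) s
          simp_rw [fun r => add_right_comm r s s'] at this
          rw [this]
          exact eLpNorm_mono_measure _ (Measure.restrict_mono
            (Icc_subset_Icc (by linarith) (by linarith)) le_rfl)

/-- Translations are continuous in `L^p`. -/
lemma tendsto_eLpNorm_comp_add_sub (hp1 : 1 ≤ p) (hp : p ≠ ∞) {F : ℝ → ℝ}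
    (hF : MemLp F p volume) :
    Tendsto (fun s => eLpNorm (fun r => F (r + s) - F r) p volume) (𝓝 0) (𝓝 0) := by
  have : Fact (1 ≤ p) := ⟨hp1⟩
  -- Currying addition makes the translations a continuous family of measure preserving maps, along
  -- which composition is continuous in L^p.
  let g : C(ℝ, C(ℝ, ℝ)) := (ContinuousMap.mk (fun a : ℝ × ℝ => a.2 + a.1) (by fun_prop)).curry
  have hg : ∀ s, MeasurePreserving (g s) volume volume :=
    fun s => measurePreserving_add_right volume s
  have hc := (tendsto_const_nhds (x := hF.toLp F) (f := 𝓝 (0 : ℝ))).compMeasurePreservingLp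
    (g.continuous.tendsto 0) hg (hg 0) hp
  rw [tendsto_iff_edist_tendsto_0] at hc
  refine hc.congr fun s => ?_
  rw [Lp.toLp_compMeasurePreserving, Lp.toLp_compMeasurePreserving, Lp.edist_toLp_toLp]
  congr 1
  ext r
  simp [g]

/-- Extend `f` by zero to the line; on [0, 1 - s] both r and r + s lie in [0, 1], so the increments
agree. -/
lemma tendsto_incrNorm (hp1 : 1 ≤ p) (hp : p ≠ ∞) (hf : MemLp f p (volume.restrict (Icc 0 1))) :
    Tendsto (incrNorm p f) (𝓝[≥] 0) (𝓝 0) := by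
  have hF : MemLp ((Icc (0 : ℝ) 1).indicator f) p volume :=
    (memLp_indicator_iff_restrict measurableSet_Icc).2 hf
  refine tendsto_of_tendsto_of_tendsto_of_le_of_le' tendsto_const_nhds
    ((tendsto_eLpNorm_comp_add_sub hp1 hp hF).mono_left nhdsWithin_le_nhds)
    (.of_forall fun _ => zero_le) ?_
  filter_upwards [self_mem_nhdsWithin] with s hs
  have hs : 0 ≤ s := hs
  refine le_trans (le_of_eq ?_) (eLpNorm_mono_measure _
    (Measure.restrict_le_self (s := Icc 0 (1 - s))))
  refine eLpNorm_congr_ae (ae_restrict_of_forall_mem measurableSet_Icc fun r hr => ?_)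
  have h1 : r ∈ Icc (0 : ℝ) 1 := ⟨hr.1, by linarith [hr.2]⟩
  have h2 : r + s ∈ Icc (0 : ℝ) 1 := ⟨by linarith [hr.1], by linarith [hr.2]⟩
  simp only [indicator_of_mem h1, indicator_of_mem h2]

lemma eLpNorm_increment_eq_incrNorm (s : ℝ) :
    eLpNorm (fun r => f (r + s) - f r) p
      (volume.restrict {r | r ∈ Icc (0 : ℝ) 1 ∧ r + s ∈ Icc (0 : ℝ) 1}) = incrNorm p f |s| := by
  rcases le_total 0 s with hs | hs
  · have : {r | r ∈ Icc (0 : ℝ) 1 ∧ r + s ∈ Icc (0 : ℝ) 1} = Icc 0 (1 - s) := by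
      ext r
      simp only [mem_ofPred_eq, mem_Icc]
      constructor
      · rintro ⟨⟨h1, h2⟩, h3, h4⟩; constructor <;> linarith
      · rintro ⟨h1, h2⟩; refine ⟨⟨?_, ?_⟩, ?_, ?_⟩ <;> linarith
    rw [this, abs_of_nonneg hs, incrNorm]
  -- For a negative shift the domain is written as a translate by -s, so that a change of variables
  -- exchanges the roles of r and r + s.
  · have : {r | r ∈ Icc (0 : ℝ) 1 ∧ r + s ∈ Icc (0 : ℝ) 1} = Icc (0 + -s) (1 - -s + -s) := by
      ext r
      simp only [mem_ofPred_eq, mem_Icc]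
      constructor
      · rintro ⟨⟨h1, h2⟩, h3, h4⟩; constructor <;> linarith
      · rintro ⟨h1, h2⟩; refine ⟨⟨?_, ?_⟩, ?_, ?_⟩ <;> linarith
    rw [this, abs_of_nonpos hs, ← eLpNorm_comp_add_right, incrNorm, ← eLpNorm_neg]
    congr 1
    ext r
    simp

lemma lpModulus_Icc (t : ℝ) :
    lpModulus p f (Icc 0 1) t = ⨆ (s : ℝ) (_ : |s| ≤ t), incrNorm p f |s| := by
  unfold lpModulus
  simp_rw [eLpNorm_increment_eq_incrNorm]

/-- Dyadic criterion for membership in the Besov space. -/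
lemma memBesov_of_dyadic (hp1 : 1 ≤ p) (hp : p ≠ ∞) {α : ℝ} (hα : 0 < α)
    (hf : MemLp f p (volume.restrict (Icc 0 1))) {K : ℝ≥0∞} (hK : K ≠ ∞)
    (hdy : ∀ n : ℕ, incrNorm p f ((1 / 2 : ℝ) ^ n)
      ≤ K * ENNReal.ofReal (((1 / 2 : ℝ) ^ n) ^ α)) : MemBesov α p (Icc 0 1) f := by
  refine ⟨hf, ENNReal.add_lt_top.2 ⟨hf.eLpNorm_lt_top, ?_⟩⟩
  have hθ' : 0 < 1 - (1 / 2 : ℝ) ^ α :=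
    sub_pos.2 (Real.rpow_lt_one (by norm_num) (by norm_num) hα)
  have hC : K * ENNReal.ofReal (1 - (1 / 2) ^ α)⁻¹ < ∞ :=
    ENNReal.mul_lt_top hK.lt_top ENNReal.ofReal_lt_top
  refine lt_of_le_of_lt (iSup₂_le fun t ht => ?_) hC
  refine ENNReal.div_le_of_le_mul ?_
  rw [lpModulus_Icc]
  refine iSup₂_le fun s hs => ?_
  refine (le_of_subadditive_of_dyadic hα
    (fun s s' h h' _ => incrNorm_add_le hp1 hf.aestronglyMeasurable h h') hdy
    (tendsto_incrNorm hp1 hp hf) (abs_nonneg s) (hs.trans ht.2)).trans ?_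
  rw [mul_assoc, ← ENNReal.ofReal_mul (inv_nonneg.2 hθ'.le), div_eq_inv_mul]
  gcongr

lemma MemBesovZero.tendsto_dyadic {α : ℝ} (h : MemBesovZero α p (Icc 0 1) f) :
    Tendsto (fun n : ℕ => incrNorm p f ((1 / 2 : ℝ) ^ n)
      / ENNReal.ofReal (((1 / 2 : ℝ) ^ n) ^ α)) atTop (𝓝 0) := by
  have hlim : Tendsto (fun n : ℕ => (1 / 2 : ℝ) ^ n) atTop (𝓝[>] 0) :=
    tendsto_nhdsWithin_iff.2 ⟨tendsto_pow_atTop_nhds_zero_of_lt_one (by norm_num) (by norm_num),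
      .of_forall fun n => by simp only [mem_Ioi]; positivity⟩
  refine tendsto_of_tendsto_of_tendsto_of_le_of_le tendsto_const_nhds (h.2.comp hlim)
    (fun _ => zero_le) fun n => ?_
  simp only [Function.comp_apply]
  refine ENNReal.div_le_div_right ?_ _
  rw [lpModulus_Icc]
  have e : |(1 / 2 : ℝ) ^ n| = (1 / 2) ^ n := abs_of_pos (by positivity)
  refine le_trans (le_of_eq ?_) (le_iSup₂_of_le ((1 / 2 : ℝ) ^ n) e.le le_rfl)
  rw [e]

end Translation

/-! ### Almost sure behaviour of the sample paths. -/

section Paths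

variable {Ω : Type*} [MeasurableSpace Ω] {P : Measure Ω}
  {W : ℝ≥0 × BddBorel → Ω → ℝ} {u : ℝ → ℝ → Ω → ℝ} {p : ℝ≥0∞}

lemma lintegral_enorm_rpow_of_map {X : Ω → ℝ} {v : ℝ≥0} {q : ℝ} (hq : 0 ≤ q)
    (hX : AEMeasurable X P) (h : P.map X = gaussianReal 0 v) :
    ∫⁻ ω, ‖X ω‖ₑ ^ q ∂P = ENNReal.ofReal (√(v : ℝ) ^ q * absMoment q) := by
  rw [← integral_abs_rpow_of_map hX h,
    ofReal_integral_eq_lintegral_ofReal (integrable_abs_rpow_of_map hq hX h)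
      (.of_forall fun _ => by positivity)]
  refine lintegral_congr fun ω => ?_
  rw [Real.enorm_eq_ofReal_abs, ENNReal.ofReal_rpow_of_nonneg (abs_nonneg _) hq]

lemma IsMildSolution.ae_memLp [IsProbabilityMeasure P]
    (hW : IsWhiteNoise P W) (hu : IsMildSolution P W u) (x : ℝ)
    (hp0 : p ≠ 0) (hp : p ≠ ∞) :
    ∀ᵐ ω ∂P, MemLp (fun t => u t x ω) p (volume.restrict (Icc 0 1)) := by
  refine MemLp.ae_memLp_section (Y := fun z => u z.1 x z.2) hp0 hp ?_
  refine memLp_of_lintegral_le hp0 hp (hu.aestronglyMeasurable_comp x (f := id)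
    ((MeasurePreserving.id volume).quasiMeasurePreserving.restrict fun _ hr => hr.1))
    -- The variance at time t is κ√(2t), at most κ√2 on [0, 1].
    (B := ENNReal.ofReal (√(kappa * √2) ^ p.toReal * absMoment p.toReal))
    ENNReal.ofReal_ne_top ?_
  refine ae_restrict_of_forall_mem measurableSet_Icc fun t ht => ?_
  have hwi := hu.isWienerIntegral t ht.1 x
  rw [lintegral_enorm_rpow_of_map ENNReal.toReal_nonneg hwi.aemeasurable
    (hwi.map_eq_gaussianReal hW)]
  refine ENNReal.ofReal_le_ofReal (mul_le_mul_of_nonneg_right ?_ (absMoment_nonneg _))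
  refine Real.rpow_le_rpow (Real.sqrt_nonneg _) (Real.sqrt_le_sqrt ?_) ENNReal.toReal_nonneg
  rw [Real.coe_toNNReal _ (integral_nonneg fun _ => sq_nonneg _)]
  simp_rw [sq]
  rw [hu.integral_mul hW ht.1 ht.1, timeCov, sub_self, abs_zero, Real.sqrt_zero, sub_zero]
  exact mul_le_mul_of_nonneg_left (Real.sqrt_le_sqrt (by linarith [ht.2])) kappa_pos.le

/-- Along `h = 2^{-n}`, the `L^p` norms of the normalised increments converge almost surely to
a positive constant. -/
lemma IsMildSolution.ae_tendsto_eLpNorm_normIncr [IsProbabilityMeasure P]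
    (hW : IsWhiteNoise P W)
    (hu : IsMildSolution P W u) (x : ℝ) (hp1 : 1 ≤ p) (hp : p ≠ ∞) :
    ∀ᵐ ω ∂P, (∀ n : ℕ, eLpNorm (fun r => normIncr u x ((1 / 2 : ℝ) ^ n) r ω) p
        (volume.restrict (Icc 0 (1 - (1 / 2 : ℝ) ^ n))) ≠ ∞) ∧
      Tendsto (fun n : ℕ => eLpNorm (fun r => normIncr u x ((1 / 2 : ℝ) ^ n) r ω) p
        (volume.restrict (Icc 0 (1 - (1 / 2 : ℝ) ^ n)))) atTop
        (𝓝 (ENNReal.ofReal (absMoment p.toReal ^ p.toReal⁻¹))) := by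
  have hp0 : p ≠ 0 := (zero_lt_one.trans_le hp1).ne'
  set q := p.toReal with hq
  have hq1 : 1 ≤ q := by simpa using (ENNReal.toReal_le_toReal ENNReal.one_ne_top hp).2 hp1
  have hpos : ∀ n : ℕ, 0 < (1 / 2 : ℝ) ^ n := fun n => by positivity
  have hmem : ∀ᵐ ω ∂P, ∀ n : ℕ, MemLp (fun r => normIncr u x ((1 / 2 : ℝ) ^ n) r ω) p
      (volume.restrict (Icc 0 (1 - (1 / 2 : ℝ) ^ n))) := by
    rw [ae_all_iff]
    intro n
    refine MemLp.ae_memLp_section (Y := fun z => normIncr u x ((1 / 2 : ℝ) ^ n) z.1 z.2) hp0 hp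
      (memLp_of_lintegral_le hp0 hp (hu.aestronglyMeasurable_normIncr x (hpos n).le)
      (B := ENNReal.ofReal (absMoment q)) ENNReal.ofReal_ne_top ?_)
    refine ae_restrict_of_forall_mem measurableSet_Icc fun r hr => le_of_eq ?_
    rw [lintegral_enorm_rpow_of_map ENNReal.toReal_nonneg
      (hu.hasGaussianLaw_normIncr hW (hpos n).le hr.1 hr.1 x).fst.aemeasurable
      (hu.map_normIncr hW (hpos n) hr.1 x)]
    simp [hq]
  filter_upwards [hmem, hu.ae_tendsto_setIntegral_centredPow hW x hq1] with ω hω hlim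
  refine ⟨fun n => (hω n).eLpNorm_ne_top, ?_⟩
  -- Undo the centring: the mean contributes `absMoment q` times the length 1 - 2^{-n}, which tends
  -- to 1.
  have hint : ∀ n : ℕ, ∫ r in Icc 0 (1 - (1 / 2 : ℝ) ^ n),
      ‖normIncr u x ((1 / 2 : ℝ) ^ n) r ω‖ ^ q
      = (∫ r in Icc 0 (1 - (1 / 2 : ℝ) ^ n), centredPow u x q ((1 / 2 : ℝ) ^ n) (r, ω))
        + (1 - (1 / 2 : ℝ) ^ n) * absMoment q := fun n => by
    have hi : Integrable (fun r => |normIncr u x ((1 / 2 : ℝ) ^ n) r ω| ^ q)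
        (volume.restrict (Icc 0 (1 - (1 / 2 : ℝ) ^ n))) := (hω n).integrable_norm_rpow hp0 hp
    have hle : (1 / 2 : ℝ) ^ n ≤ 1 := pow_le_one₀ (by norm_num) (by norm_num)
    simp only [centredPow, Real.norm_eq_abs]
    rw [integral_sub hi (integrable_const _), setIntegral_const, Real.volume_real_Icc,
      max_eq_left (by linarith)]
    simp
  have hpow : Tendsto (fun n : ℕ => (1 / 2 : ℝ) ^ n) atTop (𝓝 0) :=
    tendsto_pow_atTop_nhds_zero_of_lt_one (by norm_num) (by norm_num)
  have hlim2 : Tendsto (fun n : ℕ => ∫ r in Icc 0 (1 - (1 / 2 : ℝ) ^ n),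
      ‖normIncr u x ((1 / 2 : ℝ) ^ n) r ω‖ ^ q) atTop (𝓝 (absMoment q)) := by
    simp_rw [hint]
    simpa using hlim.add ((hpow.const_sub 1).mul_const (absMoment q))
  simp_rw [fun n => (hω n).eLpNorm_eq_integral_rpow_norm hp0 hp]
  exact ENNReal.tendsto_ofReal (hlim2.rpow_const (Or.inr (by positivity)))

/-- The source of the exponent 1/4: a variance of order √h is a standard deviation of order h^{1/4}.
-/
lemma sqrt_mul_sqrt_eq {c h : ℝ} (hc : 0 ≤ c) (hh : 0 ≤ h) :
    √(c * √h) = √c * h ^ (1 / 4 : ℝ) := by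
  rw [Real.sqrt_mul hc, Real.sqrt_eq_rpow, Real.sqrt_eq_rpow (√h), Real.sqrt_eq_rpow h,
    ← Real.rpow_mul hh]
  norm_num

lemma eq_incrStd_mul_normIncr {Ω : Type*} {u : ℝ → ℝ → Ω → ℝ} {h r : ℝ} (hh : 0 < h) (hr : 0 ≤ r) (x : ℝ) (ω : Ω) :
    u (r + h) x ω - u r x ω = incrStd h r * normIncr u x h r ω := by
  rw [normIncr, mul_inv_cancel_left₀ (incrStd_pos hh hr).ne']

lemma incrNorm_le_eLpNorm_normIncr {Ω : Type*} {u : ℝ → ℝ → Ω → ℝ} {h : ℝ} (hh : 0 < h) (x : ℝ) (ω : Ω) :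
    incrNorm p (fun t => u t x ω) h ≤ ENNReal.ofReal (√(3 * kappa) * h ^ (1 / 4 : ℝ)) *
      eLpNorm (fun r => normIncr u x h r ω) p (volume.restrict (Icc 0 (1 - h))) := by
  refine eLpNorm_le_mul_eLpNorm_of_ae_le_mul
    (ae_restrict_of_forall_mem measurableSet_Icc fun r hr => ?_) p
  rw [eq_incrStd_mul_normIncr hh hr.1, norm_mul, Real.norm_of_nonneg (incrStd_pos hh hr.1).le,
    ← sqrt_mul_sqrt_eq (mul_nonneg (by norm_num) kappa_pos.le) hh.le]
  exact mul_le_mul_of_nonneg_right (incrStd_le hh.le hr.1) (norm_nonneg _)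

lemma eLpNorm_normIncr_le_incrNorm {Ω : Type*} {u : ℝ → ℝ → Ω → ℝ} {h : ℝ} (hh : 0 < h) (x : ℝ) (ω : Ω) :
    eLpNorm (fun r => normIncr u x h r ω) p (volume.restrict (Icc 0 (1 - h)))
      ≤ ENNReal.ofReal (√kappa * h ^ (1 / 4 : ℝ))⁻¹ * incrNorm p (fun t => u t x ω) h := by
  have hk := kappa_pos
  refine eLpNorm_le_mul_eLpNorm_of_ae_le_mul
    (ae_restrict_of_forall_mem measurableSet_Icc fun r hr => ?_) p
  rw [eq_incrStd_mul_normIncr hh hr.1, norm_mul, Real.norm_of_nonneg (incrStd_pos hh hr.1).le,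
    ← sqrt_mul_sqrt_eq hk.le hh.le, ← mul_assoc]
  have hs : 0 < √(kappa * √h) := Real.sqrt_pos.2 (mul_pos hk (Real.sqrt_pos.2 hh))
  refine le_mul_of_one_le_left (norm_nonneg _) ?_
  rw [inv_mul_eq_div, one_le_div hs]
  exact sq_le_incrStd hh.le hr.1

/-- Termwise finiteness is needed because convergence controls only the tail. -/
lemma exists_ne_top_forall_le_of_tendsto {a : ℕ → ℝ≥0∞} {L : ℝ≥0∞} (hL : L ≠ ∞)
    (ha : ∀ n, a n ≠ ∞) (h : Tendsto a atTop (𝓝 L)) : ∃ K, K ≠ ∞ ∧ ∀ n, a n ≤ K := by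
  obtain ⟨B, hB⟩ := ((ENNReal.tendsto_toReal hL).comp h).bddAbove_range
  refine ⟨ENNReal.ofReal B, ENNReal.ofReal_ne_top, fun n => ?_⟩
  exact ENNReal.le_ofReal_iff_toReal_le (ha n) (ENNReal.toReal_nonneg.trans (hB ⟨0, rfl⟩)) |>.2
    (hB ⟨n, rfl⟩)

variable [IsProbabilityMeasure P]

theorem IsMildSolution.ae_memBesov (hW : IsWhiteNoise P W) (hu : IsMildSolution P W u) (x : ℝ)
    (hp1 : 1 ≤ p) (hp : p ≠ ∞) :
    ∀ᵐ ω ∂P, MemBesov (1 / 4) p (Icc 0 1) (fun t => u t x ω) := by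
  have hpos : ∀ n : ℕ, 0 < (1 / 2 : ℝ) ^ n := fun n => by positivity
  filter_upwards [hu.ae_tendsto_eLpNorm_normIncr hW x hp1 hp,
    hu.ae_memLp hW x (zero_lt_one.trans_le hp1).ne' hp] with ω ⟨hfin, hlim⟩ hmem
  obtain ⟨K, hK, hle⟩ := exists_ne_top_forall_le_of_tendsto ENNReal.ofReal_ne_top hfin hlim
  refine memBesov_of_dyadic hp1 hp (by norm_num) hmem
    (K := ENNReal.ofReal √(3 * kappa) * K) (ENNReal.mul_ne_top ENNReal.ofReal_ne_top hK)
    fun n => ?_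
  refine (incrNorm_le_eLpNorm_normIncr (hpos n) x ω).trans ?_
  rw [ENNReal.ofReal_mul (Real.sqrt_nonneg _), mul_right_comm]
  gcongr
  exact hle n

/-- Little-o decay at dyadic shifts would force the normalised L^p norms to 0, against their
positive limit. -/
theorem IsMildSolution.ae_not_memBesovZero (hW : IsWhiteNoise P W) (hu : IsMildSolution P W u)
    (x : ℝ) (hp1 : 1 ≤ p) (hp : p ≠ ∞) :
    ∀ᵐ ω ∂P, ¬ MemBesovZero (1 / 4) p (Icc 0 1) (fun t => u t x ω) := by
  have hpos : ∀ n : ℕ, 0 < (1 / 2 : ℝ) ^ n := fun n => by positivity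
  filter_upwards [hu.ae_tendsto_eLpNorm_normIncr hW x hp1 hp] with ω ⟨_, hlim⟩ hzero
  have h0 := ENNReal.Tendsto.const_mul (a := ENNReal.ofReal (√kappa)⁻¹) hzero.tendsto_dyadic
    (Or.inr ENNReal.ofReal_ne_top)
  rw [mul_zero] at h0
  have hk : 0 < √kappa := Real.sqrt_pos.2 kappa_pos
  have h1 : Tendsto (fun n : ℕ => eLpNorm (fun r => normIncr u x ((1 / 2 : ℝ) ^ n) r ω) p
      (volume.restrict (Icc 0 (1 - (1 / 2 : ℝ) ^ n)))) atTop (𝓝 0) := by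
    refine tendsto_of_tendsto_of_tendsto_of_le_of_le tendsto_const_nhds
      h0 (fun _ => zero_le) fun n => ?_
    refine (eLpNorm_normIncr_le_incrNorm (hpos n) x ω).trans (le_of_eq ?_)
    have hr : 0 < ((1 / 2 : ℝ) ^ n) ^ (1 / 4 : ℝ) := Real.rpow_pos_of_pos (hpos n) _
    rw [mul_inv, ENNReal.ofReal_mul (inv_nonneg.2 hk.le), ENNReal.ofReal_inv_of_pos hr,
      ENNReal.div_eq_inv_mul, mul_assoc]
  have h2 := tendsto_nhds_unique hlim h1
  have h3 : 0 < absMoment p.toReal ^ p.toReal⁻¹ :=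
    Real.rpow_pos_of_pos (absMoment_pos ENNReal.toReal_nonneg) _
  exact (ENNReal.ofReal_pos.2 h3).ne' h2

end Paths

end StochHeat

theorem theorem2p1 {Ω : Type*} [MeasurableSpace Ω] (P : Measure Ω) [IsProbabilityMeasure P]
    (W : ℝ≥0 × StochHeat.BddBorel → Ω → ℝ) (hW : StochHeat.IsWhiteNoise P W)
    (u : ℝ → ℝ → Ω → ℝ) (hu : StochHeat.IsMildSolution P W u)
    (x : ℝ) (p : ℝ≥0∞) (hp4 : 4 < p) (hp : p < ∞) :
    (∀ᵐ ω ∂P, StochHeat.MemBesov (1 / 4) p (Icc 0 1) (fun t => u t x ω)) ∧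
    (∀ᵐ ω ∂P, ¬ StochHeat.MemBesovZero (1 / 4) p (Icc 0 1) (fun t => u t x ω)) := by
  have hp1 : 1 ≤ p := le_trans (by norm_num) hp4.le
  exact ⟨hu.ae_memBesov hW x hp1 hp.ne, hu.ae_not_memBesovZero hW x hp1 hp.ne⟩
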